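/- Let $q,a,b,c,d$ be complex numbers such that $q\ne0$, $q^m\ne1$ for $m=1,2,\dots$, $a,b,c,d\ne0$, and $abcd\ne q^{-m}$ for $m=0,1,2,\dots$. Let $e_1,e_2,e_3,e_4$ be the elementary symmetric polynomials in $a,b,c,d$ (so $e_4=abcd$), and put $$B=(1-q^{-1})^2(e_3+qe_1),\quad C_0=(q-q^{-1})^2,\quad C_1=q^{-1}(q-q^{-1})^2e_4,$$ $$D_0=-q^{-3}(1-q)^2(1+q)(e_4+qe_2+q^2),\quad D_1=-q^{-3}(1-q)^2(1+q)(e_1e_4+qe_3),$$ $$E=-q^{-2}(1-q)^3(c+d),\quad F_0=q^{-3}(1-q)^3(1+q)(cd+q),\quad F_1=q^{-3}(1-q)^3(1+q)(a+b)cd,$$ $$G=-q^{-4}(1-q)^3\Bigl((a+b)(c+d)\bigl(cd(q^2+1)+q\bigr)-q(ab+1)\bigl((c^2+d^2)(q+1)-cd\bigr)+(cd+e_4)(q^2+1)+(e_2+e_4-ab)q^3\Bigr),$$ $$Q_0=q^{-4}(1-q)^2\Bigl(q^4(e_4-e_2)+q^3(e_1^2-e_1e_3-2e_2)-q^2(e_2e_4+2e_4+e_2)+q(e_3^2-2e_2e_4-e_1e_3)+e_4(1-e_2)\Bigr).$$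 Let $\widetilde{AW}(3,Q_0)$ be the unital associative $\mathbb C$-algebra generated by $K_0,K_1,T_1$ with relations $$T_1K_0=K_0T_1,\qquad T_1K_1=K_1T_1,\qquad (T_1+ab)(T_1+1)=0,$$ $$(q+q^{-1})K_1K_0K_1-K_1^2K_0-K_0K_1^2=BK_1+C_0K_0+D_0+EK_1(T_1+ab)+F_0(T_1+ab),$$ $$(q+q^{-1})K_0K_1K_0-K_0^2K_1-K_1K_0^2=BK_0+C_1K_1+D_1+EK_0(T_1+ab)+F_1(T_1+ab),$$ and $\widetilde Q=Q_0$, where $$\begin{aligned}\widetilde Q={}&(K_1K_0)^2-(q^2+1+q^{-2})K_0(K_1K_0)K_1+(q+q^{-1})K_0^2K_1^2+(q+q^{-1})(C_0K_0^2+C_1K_1^2)\\&+\bigl(B+E(T_1+ab)\bigr)\bigl((q+1+q^{-1})K_0K_1+K_1K_0\bigr)\\&+(q+1+q^{-1})\bigl(D_0+F_0(T_1+ab)\bigr)K_0+(q+1+q^{-1})\bigl(D_1+F_1(T_1+ab)\bigr)K_1+G(T_1+ab).\end{aligned}$$ Let $\tilde{\mathfrak H}$ be the double affine Hecke algebra of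 type $(C_1^\vee,C_1)$: the unital associative $\mathbb C$-algebra generated by $Z,Z^{-1},T_1,T_0$ with relations $ZZ^{-1}=1=Z^{-1}Z$ and $$(T_1+ab)(T_1+1)=0,\quad (T_0+q^{-1}cd)(T_0+1)=0,\quad (T_1Z+a)(T_1Z+b)=0,\quad (qT_0Z^{-1}+c)(qT_0Z^{-1}+d)=0.$$ Then $Y:=T_1T_0$ is invertible in $\tilde{\mathfrak H}$, and there is an injective homomorphism of unital $\mathbb C$-algebras $\widetilde{AW}(3,Q_0)\to\tilde{\mathfrak H}$ such that $$K_0\mapsto Y+q^{-1}abcd\,Y^{-1},\qquad K_1\mapsto Z+Z^{-1},\qquad T_1\mapsto T_1.$$ -/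

import Mathlib

noncomputable section

namespace ZhedanovDAHA

/-! ### Structure constants

All of them are functions of the five complex parameters `q, a, b, c, d`. -/

/-- Elementary symmetric polynomials in `a, b, c, d`. -/
def e₁ (a b c d : ℂ) : ℂ := a + b + c + d
def e₂ (a b c d : ℂ) : ℂ := a * b + a * c + b * c + a * d + b * d + c * d
def e₃ (a b c d : ℂ) : ℂ := a * b * c + a * b * d + a * c * d + b * c * d
def e₄ (a b c d : ℂ) : ℂ := a * b * c * d

def constB (q a b c d : ℂ) : ℂ := (1 - q⁻¹) ^ 2 * (e₃ a b c d + q * e₁ a b c d)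

def constC₀ (q : ℂ) : ℂ := (q - q⁻¹) ^ 2

def constC₁ (q a b c d : ℂ) : ℂ := q⁻¹ * (q - q⁻¹) ^ 2 * e₄ a b c d

def constD₀ (q a b c d : ℂ) : ℂ :=
  -(q⁻¹ ^ 3) * (1 - q) ^ 2 * (1 + q) * (e₄ a b c d + q * e₂ a b c d + q ^ 2)

def constD₁ (q a b c d : ℂ) : ℂ :=
  -(q⁻¹ ^ 3) * (1 - q) ^ 2 * (1 + q) * (e₁ a b c d * e₄ a b c d + q * e₃ a b c d)

def constE (q c d : ℂ) : ℂ := -(q⁻¹ ^ 2) * (1 - q) ^ 3 * (c + d)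

def constF₀ (q c d : ℂ) : ℂ := q⁻¹ ^ 3 * (1 - q) ^ 3 * (1 + q) * (c * d + q)

def constF₁ (q a b c d : ℂ) : ℂ := q⁻¹ ^ 3 * (1 - q) ^ 3 * (1 + q) * (a + b) * (c * d)

def constG (q a b c d : ℂ) : ℂ :=
  -(q⁻¹ ^ 4) * (1 - q) ^ 3 *
    ((a + b) * (c + d) * (c * d * (q ^ 2 + 1) + q)
      - q * (a * b + 1) * ((c ^ 2 + d ^ 2) * (q + 1) - c * d)
      + (c * d + e₄ a b c d) * (q ^ 2 + 1)
      + (e₂ a b c d + e₄ a b c d - a * b) * q ^ 3)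

/-- The value prescribed for the Casimir element. -/
def constQ₀ (q a b c d : ℂ) : ℂ :=
  q⁻¹ ^ 4 * (1 - q) ^ 2 *
    (q ^ 4 * (e₄ a b c d - e₂ a b c d)
      + q ^ 3 * (e₁ a b c d ^ 2 - e₁ a b c d * e₃ a b c d - 2 * e₂ a b c d)
      - q ^ 2 * (e₂ a b c d * e₄ a b c d + 2 * e₄ a b c d + e₂ a b c d)
      + q * (e₃ a b c d ^ 2 - 2 * e₂ a b c d * e₄ a b c d - e₁ a b c d * e₃ a b c d)
      + e₄ a b c d * (1 - e₂ a b c d))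

/-! ### The double affine Hecke algebra of type `(C₁^∨, C₁)` -/

/-- The four generators `Z, Z⁻¹, T₁, T₀`. -/
inductive DAHAGen : Type
  | Z
  | Zinv
  | T₁
  | T₀

open DAHAGen in
/-- The defining relations, in the free unital associative `ℂ`-algebra on the generators. -/
inductive DAHARel (q a b c d : ℂ) :
    FreeAlgebra ℂ DAHAGen → FreeAlgebra ℂ DAHAGen → Prop
  | Z_mul_Zinv : DAHARel q a b c d (FreeAlgebra.ι ℂ Z * FreeAlgebra.ι ℂ Zinv) 1
  | Zinv_mul_Z : DAHARel q a b c d (FreeAlgebra.ι ℂ Zinv * FreeAlgebra.ι ℂ Z) 1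
  | quad_T₁ : DAHARel q a b c d
      ((FreeAlgebra.ι ℂ T₁ + algebraMap ℂ _ (a * b)) * (FreeAlgebra.ι ℂ T₁ + 1)) 0
  | quad_T₀ : DAHARel q a b c d
      ((FreeAlgebra.ι ℂ T₀ + algebraMap ℂ _ (q⁻¹ * c * d)) * (FreeAlgebra.ι ℂ T₀ + 1)) 0
  | quad_T₁Z : DAHARel q a b c d
      ((FreeAlgebra.ι ℂ T₁ * FreeAlgebra.ι ℂ Z + algebraMap ℂ _ a) *
        (FreeAlgebra.ι ℂ T₁ * FreeAlgebra.ι ℂ Z + algebraMap ℂ _ b)) 0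
  | quad_T₀Zinv : DAHARel q a b c d
      ((q • (FreeAlgebra.ι ℂ T₀ * FreeAlgebra.ι ℂ Zinv) + algebraMap ℂ _ c) *
        (q • (FreeAlgebra.ι ℂ T₀ * FreeAlgebra.ι ℂ Zinv) + algebraMap ℂ _ d)) 0

/-- The double affine Hecke algebra of type `(C₁^∨, C₁)`, by generators and relations. -/
abbrev DAHA (q a b c d : ℂ) : Type := RingQuot (DAHARel q a b c d)

/-- The image of a generator in the double affine Hecke algebra. -/
def DAHA.gen (q a b c d : ℂ) (x : DAHAGen) : DAHA q a b c d :=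
  RingQuot.mkAlgHom ℂ (DAHARel q a b c d) (FreeAlgebra.ι ℂ x)

/-! ### The central extension of the Askey-Wilson algebra -/

/-- The three generators `K₀, K₁, T₁`. -/
inductive AWGen : Type
  | K₀
  | K₁
  | T₁

/-- The (adapted) Casimir expression `Q̃`, evaluated at elements `k₀, k₁, t` of a `ℂ`-algebra. -/
def casimir {A : Type*} [Ring A] [Algebra ℂ A] (q a b c d : ℂ) (k₀ k₁ t : A) : A :=
  (k₁ * k₀) ^ 2 - (q ^ 2 + 1 + q⁻¹ ^ 2) • (k₀ * (k₁ * k₀) * k₁)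
    + (q + q⁻¹) • (k₀ ^ 2 * k₁ ^ 2)
    + (q + q⁻¹) • (constC₀ q • k₀ ^ 2 + constC₁ q a b c d • k₁ ^ 2)
    + (algebraMap ℂ A (constB q a b c d) + constE q c d • (t + algebraMap ℂ A (a * b))) *
        ((q + 1 + q⁻¹) • (k₀ * k₁) + k₁ * k₀)
    + (q + 1 + q⁻¹) •
        ((algebraMap ℂ A (constD₀ q a b c d)
          + constF₀ q c d • (t + algebraMap ℂ A (a * b))) * k₀)
    + (q + 1 + q⁻¹) •
        ((algebraMap ℂ A (constD₁ q a b c d)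
          + constF₁ q a b c d • (t + algebraMap ℂ A (a * b))) * k₁)
    + constG q a b c d • (t + algebraMap ℂ A (a * b))

open AWGen in
/-- The defining relations, in the free unital associative `ℂ`-algebra on the generators. -/
inductive AWRel (q a b c d : ℂ) : FreeAlgebra ℂ AWGen → FreeAlgebra ℂ AWGen → Prop
  | comm_T₁_K₀ : AWRel q a b c d
      (FreeAlgebra.ι ℂ T₁ * FreeAlgebra.ι ℂ K₀) (FreeAlgebra.ι ℂ K₀ * FreeAlgebra.ι ℂ T₁)
  | comm_T₁_K₁ : AWRel q a b c d
      (FreeAlgebra.ι ℂ T₁ * FreeAlgebra.ι ℂ K₁) (FreeAlgebra.ι ℂ K₁ * FreeAlgebra.ι ℂ T₁)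
  | quad_T₁ : AWRel q a b c d
      ((FreeAlgebra.ι ℂ T₁ + algebraMap ℂ _ (a * b)) * (FreeAlgebra.ι ℂ T₁ + 1)) 0
  | aw₁ : AWRel q a b c d
      ((q + q⁻¹) • (FreeAlgebra.ι ℂ K₁ * FreeAlgebra.ι ℂ K₀ * FreeAlgebra.ι ℂ K₁)
        - FreeAlgebra.ι ℂ K₁ ^ 2 * FreeAlgebra.ι ℂ K₀
        - FreeAlgebra.ι ℂ K₀ * FreeAlgebra.ι ℂ K₁ ^ 2)
      (constB q a b c d • FreeAlgebra.ι ℂ K₁ + constC₀ q • FreeAlgebra.ι ℂ K₀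
        + algebraMap ℂ _ (constD₀ q a b c d)
        + constE q c d •
            (FreeAlgebra.ι ℂ K₁ * (FreeAlgebra.ι ℂ T₁ + algebraMap ℂ _ (a * b)))
        + constF₀ q c d • (FreeAlgebra.ι ℂ T₁ + algebraMap ℂ _ (a * b)))
  | aw₂ : AWRel q a b c d
      ((q + q⁻¹) • (FreeAlgebra.ι ℂ K₀ * FreeAlgebra.ι ℂ K₁ * FreeAlgebra.ι ℂ K₀)
        - FreeAlgebra.ι ℂ K₀ ^ 2 * FreeAlgebra.ι ℂ K₁
        - FreeAlgebra.ι ℂ K₁ * FreeAlgebra.ι ℂ K₀ ^ 2)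
      (constB q a b c d • FreeAlgebra.ι ℂ K₀ + constC₁ q a b c d • FreeAlgebra.ι ℂ K₁
        + algebraMap ℂ _ (constD₁ q a b c d)
        + constE q c d •
            (FreeAlgebra.ι ℂ K₀ * (FreeAlgebra.ι ℂ T₁ + algebraMap ℂ _ (a * b)))
        + constF₁ q a b c d • (FreeAlgebra.ι ℂ T₁ + algebraMap ℂ _ (a * b)))
  | casimir_eq : AWRel q a b c d
      (casimir q a b c d (FreeAlgebra.ι ℂ K₀) (FreeAlgebra.ι ℂ K₁) (FreeAlgebra.ι ℂ T₁))
      (algebraMap ℂ _ (constQ₀ q a b c d))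

/-- The central extension `AW(3, Q₀)~` of the Askey-Wilson algebra with the Casimir element set
equal to `Q₀`, by generators and relations. -/
abbrev AWExt (q a b c d : ℂ) : Type := RingQuot (AWRel q a b c d)

/-- The image of a generator in the central extension. -/
def AWExt.gen (q a b c d : ℂ) (x : AWGen) : AWExt q a b c d :=
  RingQuot.mkAlgHom ℂ (AWRel q a b c d) (FreeAlgebra.ι ℂ x)

end ZhedanovDAHA

end

noncomputable section

namespace ZhedanovDAHA

/-! The homomorphism exists because the Askey-Wilson relations are consequences of the Hecke
relations. Solving the latter gives rules moving `Z` and its inverse to the left of `T₁` and `T₀`;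
in these lemmas the letter `Y` denotes the inverse of `Z`, not `T₁ * T₀`. The image `k₀` of `K₀`
commutes with `T₁` and `T₀`, and it eliminates the word `T₀ * T₁`. Every product can therefore be
written as a Laurent monomial in `Z`, times a power of `k₀`, times one of `1, T₁, T₀, T₁ * T₀`, and
identities are checked by comparing coefficients. The work is organised around the q-commutator `kM
= k₀ k₁ - q⁻¹ k₁ k₀`: the two cubic relations are the commutation rules `kM_k₁` and `k₀_kM`, and the
Casimir relation amounts to the formula `kM_kM` for its square.

Injectivity matches a spanning set with a faithful enough representation. By
`AWExt.monomialSpan_eq_top`, the words `K₀ ^ n * w * K₁ ^ m` with `w` among `1, T₁, K₁ K₀, K₁ K₀ T₁`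
span the source. The target acts by q-difference-reflection operators on functions on an orbit `w q
^ j` and the inverse points (`rep`). There `K₁` is diagonal with eigenvalues `x j`, and `K₀` raises
the top of the support by exactly one, with unipotent leading part. A vanishing combination of words
(`orderedSum_injective`) thus yields, in top degree, identities `p (x j) + x (j + 1) * s (x j) = 0`
for all `j`. The orbit is infinite since `q` is not a root of unity, and
`eq_zero_of_eval_add_eq_zero` gives `p = s = 0`. -/

/-- A quadruple of elements of an algebra satisfying the defining relations of the double affine
Hecke algebra, written as rewriting rules that move `Z` and `Z⁻¹` to the left. -/
structure IsDAHAQuad (q a b c d : ℂ) {A : Type*} [Ring A] [Algebra ℂ A] (Z Y T₁ T₀ : A) :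
    Prop where
  ZY : Z * Y = 1
  YZ : Y * Z = 1
  T₁T₁ : T₁ * T₁ = -(1 + a * b) • T₁ - (a * b) • 1
  T₀T₀ : T₀ * T₀ = -(1 + q⁻¹ * c * d) • T₀ - (q⁻¹ * c * d) • 1
  T₁Z : T₁ * Z = Y * T₁ + (1 + a * b) • Y - (a + b) • 1
  T₁Y : T₁ * Y = Z * T₁ - (1 + a * b) • Y + (a + b) • 1
  T₀Z : T₀ * Z = q • (Y * T₀) - (1 + q⁻¹ * c * d) • Z + (c + d) • 1
  T₀Y : T₀ * Y = q⁻¹ • (Z * T₀) + (q⁻¹ * (1 + q⁻¹ * c * d)) • Z - (q⁻¹ * (c + d)) • 1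

set_option linter.unusedSimpArgs false

/-! ### Askey-Wilson relations inside the double affine Hecke algebra -/

namespace IsDAHAQuad

variable {q a b c d : ℂ} {A : Type*} [Ring A] [Algebra ℂ A] {Z Y T₁ T₀ : A}

theorem mul_assoc_of_eq {A : Type*} [Semigroup A] {x y z : A} (h : x * y = z) (w : A) :
    x * (y * w) = z * w := by
  rw [← mul_assoc, h]

/-- The image of `K₀`, written without inverses. -/
def k₀ (q a b c d : ℂ) (T₁ T₀ : A) : A :=
  T₁ * T₀ + T₀ * T₁ + (1 + a * b) • T₀ + (1 + q⁻¹ * c * d) • T₁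
    + ((1 + q⁻¹ * c * d) * (1 + a * b)) • 1

theorem T₁_k₁ (h : IsDAHAQuad q a b c d Z Y T₁ T₀) : T₁ * (Z + Y) = (Z + Y) * T₁ := by
  rw [mul_add, h.T₁Z, h.T₁Y, add_mul]; abel

theorem T₁_k₀ (h : IsDAHAQuad q a b c d Z Y T₁ T₀) :
    T₁ * k₀ q a b c d T₁ T₀ = k₀ q a b c d T₁ T₀ * T₁ := by
  simp only [k₀, mul_add, add_mul, smul_mul_assoc, mul_smul_comm, mul_assoc, h.T₁T₁,
    mul_assoc_of_eq h.T₁T₁, mul_sub, sub_mul, mul_one, one_mul]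
  module

theorem T₀_k₀ (h : IsDAHAQuad q a b c d Z Y T₁ T₀) :
    T₀ * k₀ q a b c d T₁ T₀ = k₀ q a b c d T₁ T₀ * T₀ := by
  simp only [k₀, mul_add, add_mul, smul_mul_assoc, mul_smul_comm, mul_assoc, h.T₀T₀,
    mul_assoc_of_eq h.T₀T₀, mul_sub, sub_mul, mul_one, one_mul]
  module

/-- Used as a rewriting rule: with `k₀` as a new letter, words in `T₁`, `T₀` reduce to powers of
`k₀` times `1, T₁, T₀, T₁ * T₀`. -/
theorem T₀T₁ (q a b c d : ℂ) (T₁ T₀ : A) :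
    T₀ * T₁ = k₀ q a b c d T₁ T₀ - T₁ * T₀ - (1 + a * b) • T₀ - (1 + q⁻¹ * c * d) • T₁
      - ((1 + q⁻¹ * c * d) * (1 + a * b)) • 1 := by
  rw [k₀]; abel

theorem k₀Z (h : IsDAHAQuad q a b c d Z Y T₁ T₀) (hq : q ≠ 0) :
    k₀ q a b c d T₁ T₀ * Z = q⁻¹ • (Z * k₀ q a b c d T₁ T₀) + (q - q⁻¹) • (Z * (T₁ * T₀))
      + ((q - 1) * (a + b)) • T₀ + ((1 - q⁻¹) * (c + d)) • T₁
      + ((1 - q⁻¹) * (c + d) * (1 + a * b)) • 1 := by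
  simp only [k₀, mul_add, add_mul, smul_mul_assoc, mul_smul_comm, mul_assoc, mul_sub, sub_mul,
    mul_one, one_mul, smul_add, smul_sub, smul_smul, h.T₁Z, h.T₁Y, h.T₀Z, h.T₀Y,
    mul_assoc_of_eq h.T₁Z, mul_assoc_of_eq h.T₁Y, mul_assoc_of_eq h.T₀Z, mul_assoc_of_eq h.T₀Y]
  match_scalars <;> field_simp <;> ring

theorem k₀Y (h : IsDAHAQuad q a b c d Z Y T₁ T₀) (hq : q ≠ 0) :
    k₀ q a b c d T₁ T₀ * Y = q • (Y * k₀ q a b c d T₁ T₀) - (q - q⁻¹) • (Y * (T₁ * T₀))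
      - ((q - q⁻¹) * (1 + a * b)) • (Y * T₀) - ((q - q⁻¹) * (1 + q⁻¹ * c * d)) • (Y * T₁)
      - ((q - q⁻¹) * ((1 + q⁻¹ * c * d) * (1 + a * b))) • Y
      + ((1 - q⁻¹) * (a + b)) • T₀ + ((1 - q⁻¹) * (c + d)) • T₁
      + ((1 - q⁻¹) * (a + b) * (1 + q⁻¹ * c * d)) • 1 := by
  simp only [k₀, mul_add, add_mul, smul_mul_assoc, mul_smul_comm, mul_assoc, mul_sub, sub_mul,
    mul_one, one_mul, smul_add, smul_sub, smul_smul, h.T₁Z, h.T₁Y, h.T₀Z, h.T₀Y,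
    mul_assoc_of_eq h.T₁Z, mul_assoc_of_eq h.T₁Y, mul_assoc_of_eq h.T₀Z, mul_assoc_of_eq h.T₀Y]
  match_scalars <;> field_simp <;> ring

/-- The `q`-commutator of `k₀` and `Z + Y`. -/
def kM (q a b c d : ℂ) (Z Y T₁ T₀ : A) : A :=
  (q - q⁻¹) • (Z * (T₁ * T₀) + Y * (T₀ * T₁) + (a + b) • T₀)
    + (1 - q⁻¹) • ((2 * (c + d)) • T₁
        + ((1 + q⁻¹ * c * d) * (a + b) + (1 + a * b) * (c + d)) • 1)

theorem k₀_k₁ (h : IsDAHAQuad q a b c d Z Y T₁ T₀) (hq : q ≠ 0) :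
    k₀ q a b c d T₁ T₀ * (Z + Y) = q⁻¹ • ((Z + Y) * k₀ q a b c d T₁ T₀)
      + kM q a b c d Z Y T₁ T₀ := by
  simp only [kM, k₀, mul_add, add_mul, smul_mul_assoc, mul_smul_comm, mul_assoc, mul_sub, sub_mul,
    mul_one, one_mul, smul_add, smul_sub, smul_smul, h.T₁Z, h.T₁Y, h.T₀Z, h.T₀Y,
    mul_assoc_of_eq h.T₁Z, mul_assoc_of_eq h.T₁Y, mul_assoc_of_eq h.T₀Z, mul_assoc_of_eq h.T₀Y]
  match_scalars <;> field_simp <;> ring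

set_option maxHeartbeats 4000000 in
-- Substituting `kM = k₀ k₁ - q⁻¹ k₁ k₀` turns this into the first cubic Askey-Wilson relation.
theorem kM_k₁ (h : IsDAHAQuad q a b c d Z Y T₁ T₀) (hq : q ≠ 0) :
    kM q a b c d Z Y T₁ T₀ * (Z + Y) = q • ((Z + Y) * kM q a b c d Z Y T₁ T₀) -
      (constC₀ q • k₀ q a b c d T₁ T₀
        + (Z + Y) * (algebraMap ℂ A (constB q a b c d) + constE q c d • (T₁ + algebraMap ℂ A (a * b)))
        + (algebraMap ℂ A (constD₀ q a b c d) + constF₀ q c d • (T₁ + algebraMap ℂ A (a * b)))) := by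
  have r₁ := h.T₁_k₀
  have r₂ := h.T₀_k₀
  have r₃ := T₀T₁ q a b c d T₁ T₀
  have r₄ := h.k₀Z hq
  have r₅ := h.k₀Y hq
  rw [kM]
  -- From here `k₀` is an opaque letter, so that the rules terminate in the order: `Z`, `Y`, then
  -- `K`, then `T₁`, `T₀`.
  generalize k₀ q a b c d T₁ T₀ = K at r₁ r₂ r₃ r₄ r₅ ⊢
  simp only [Algebra.algebraMap_eq_smul_one, mul_add, add_mul, smul_mul_assoc,
    mul_smul_comm, mul_assoc, mul_sub, sub_mul, mul_one, one_mul, smul_add, smul_sub, smul_smul,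
    r₁, r₂, r₃, r₄, r₅, h.ZY, h.YZ, h.T₁T₁, h.T₀T₀, h.T₁Z, h.T₁Y, h.T₀Z, h.T₀Y,
    mul_assoc_of_eq r₁, mul_assoc_of_eq r₂, mul_assoc_of_eq r₃, mul_assoc_of_eq r₄,
    mul_assoc_of_eq r₅, mul_assoc_of_eq h.ZY, mul_assoc_of_eq h.YZ, mul_assoc_of_eq h.T₁T₁,
    mul_assoc_of_eq h.T₀T₀, mul_assoc_of_eq h.T₁Z, mul_assoc_of_eq h.T₁Y,
    mul_assoc_of_eq h.T₀Z, mul_assoc_of_eq h.T₀Y]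
  simp only [constB, constC₀, constD₀, constE, constF₀, e₁, e₂, e₃, e₄]
  match_scalars <;> field_simp <;> ring

set_option maxHeartbeats 4000000 in
theorem k₀_kM (h : IsDAHAQuad q a b c d Z Y T₁ T₀) (hq : q ≠ 0) :
    k₀ q a b c d T₁ T₀ * kM q a b c d Z Y T₁ T₀ = q • (kM q a b c d Z Y T₁ T₀ * k₀ q a b c d T₁ T₀) -
      (constC₁ q a b c d • (Z + Y)
        + k₀ q a b c d T₁ T₀ *
          (algebraMap ℂ A (constB q a b c d) + constE q c d • (T₁ + algebraMap ℂ A (a * b)))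
        + (algebraMap ℂ A (constD₁ q a b c d) + constF₁ q a b c d • (T₁ + algebraMap ℂ A (a * b)))) := by
  have r₄ := h.k₀Z hq
  have r₅ := h.k₀Y hq
  have r₁ := h.T₁_k₀
  have r₂ := h.T₀_k₀
  have r₃ := T₀T₁ q a b c d T₁ T₀
  rw [kM]
  generalize k₀ q a b c d T₁ T₀ = K at r₁ r₂ r₃ r₄ r₅ ⊢
  simp only [Algebra.algebraMap_eq_smul_one, mul_add, add_mul, smul_mul_assoc,
    mul_smul_comm, mul_assoc, mul_sub, sub_mul, mul_one, one_mul, smul_add, smul_sub, smul_smul,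
    r₁, r₂, r₃, r₄, r₅, h.ZY, h.YZ, h.T₁T₁, h.T₀T₀, h.T₁Z, h.T₁Y, h.T₀Z, h.T₀Y,
    mul_assoc_of_eq r₁, mul_assoc_of_eq r₂, mul_assoc_of_eq r₃, mul_assoc_of_eq r₄,
    mul_assoc_of_eq r₅, mul_assoc_of_eq h.ZY, mul_assoc_of_eq h.YZ, mul_assoc_of_eq h.T₁T₁,
    mul_assoc_of_eq h.T₀T₀, mul_assoc_of_eq h.T₁Z, mul_assoc_of_eq h.T₁Y,
    mul_assoc_of_eq h.T₀Z, mul_assoc_of_eq h.T₀Y]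
  simp only [constB, constC₁, constD₁, constE, constF₁, e₁, e₂, e₃, e₄]
  match_scalars <;> field_simp <;> ring

set_option maxHeartbeats 4000000 in
-- This is the Casimir relation in disguise: modulo the other commutation rules, fixing the Casimir
-- element is the same as expressing the square of `kM`. The constants `constG` and `constQ₀` enter
-- only here.
theorem kM_kM (h : IsDAHAQuad q a b c d Z Y T₁ T₀) (hq : q ≠ 0) :
    kM q a b c d Z Y T₁ T₀ * kM q a b c d Z Y T₁ T₀ =
      (q * (q - q⁻¹)) • ((Z + Y) * (kM q a b c d Z Y T₁ T₀ * k₀ q a b c d T₁ T₀))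
        - (q * constC₀ q) • (k₀ q a b c d T₁ T₀ * k₀ q a b c d T₁ T₀)
        - (q * constC₁ q a b c d) • ((Z + Y) * (Z + Y))
        - (q + 1) • ((Z + Y) * (k₀ q a b c d T₁ T₀ *
          (algebraMap ℂ A (constB q a b c d) + constE q c d • (T₁ + algebraMap ℂ A (a * b)))))
        - kM q a b c d Z Y T₁ T₀ *
          (algebraMap ℂ A (constB q a b c d) + constE q c d • (T₁ + algebraMap ℂ A (a * b)))
        - (q + 1) • (k₀ q a b c d T₁ T₀ *
          (algebraMap ℂ A (constD₀ q a b c d) + constF₀ q c d • (T₁ + algebraMap ℂ A (a * b))))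
        - (q + 1) • ((Z + Y) *
          (algebraMap ℂ A (constD₁ q a b c d) + constF₁ q a b c d • (T₁ + algebraMap ℂ A (a * b))))
        - constG q a b c d • (T₁ + algebraMap ℂ A (a * b)) + algebraMap ℂ A (constQ₀ q a b c d) := by
  have r₁ := h.T₁_k₀
  have r₂ := h.T₀_k₀
  have r₃ := T₀T₁ q a b c d T₁ T₀
  have r₄ := h.k₀Z hq
  have r₅ := h.k₀Y hq
  rw [kM]
  generalize k₀ q a b c d T₁ T₀ = K at r₁ r₂ r₃ r₄ r₅ ⊢
  simp only [Algebra.algebraMap_eq_smul_one, mul_add, add_mul, smul_mul_assoc,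
    mul_smul_comm, mul_assoc, mul_sub, sub_mul, mul_one, one_mul, smul_add, smul_sub, smul_smul,
    r₁, r₂, r₃, r₄, r₅, h.ZY, h.YZ, h.T₁T₁, h.T₀T₀, h.T₁Z, h.T₁Y, h.T₀Z, h.T₀Y,
    mul_assoc_of_eq r₁, mul_assoc_of_eq r₂, mul_assoc_of_eq r₃, mul_assoc_of_eq r₄,
    mul_assoc_of_eq r₅, mul_assoc_of_eq h.ZY, mul_assoc_of_eq h.YZ, mul_assoc_of_eq h.T₁T₁,
    mul_assoc_of_eq h.T₀T₀, mul_assoc_of_eq h.T₁Z, mul_assoc_of_eq h.T₁Y,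
    mul_assoc_of_eq h.T₀Z, mul_assoc_of_eq h.T₀Y]
  simp only [constB, constC₀, constC₁, constD₀, constD₁, constE, constF₀, constF₁, constG,
    constQ₀, e₁, e₂, e₃, e₄]
  match_scalars <;> field_simp <;> ring

theorem aw₁ (h : IsDAHAQuad q a b c d Z Y T₁ T₀) (hq : q ≠ 0) :
    (q + q⁻¹) • ((Z + Y) * k₀ q a b c d T₁ T₀ * (Z + Y)) - (Z + Y) ^ 2 * k₀ q a b c d T₁ T₀
      - k₀ q a b c d T₁ T₀ * (Z + Y) ^ 2 =
    constB q a b c d • (Z + Y) + constC₀ q • k₀ q a b c d T₁ T₀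
      + algebraMap ℂ _ (constD₀ q a b c d)
      + constE q c d • ((Z + Y) * (T₁ + algebraMap ℂ _ (a * b)))
      + constF₀ q c d • (T₁ + algebraMap ℂ _ (a * b)) := by
  have r₁ := h.k₀_k₁ hq
  have r₂ := h.kM_k₁ hq
  generalize k₀ q a b c d T₁ T₀ = K at r₁ r₂ ⊢
  generalize kM q a b c d Z Y T₁ T₀ = M at r₁ r₂ ⊢
  generalize Z + Y = X at r₁ r₂ ⊢
  simp only [sq, mul_assoc, r₁, r₂, mul_assoc_of_eq r₁, mul_add, add_mul, smul_mul_assoc,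
    mul_smul_comm, Algebra.algebraMap_eq_smul_one, mul_one, smul_add]
  match_scalars <;> field_simp <;> ring

theorem aw₂ (h : IsDAHAQuad q a b c d Z Y T₁ T₀) (hq : q ≠ 0) :
    (q + q⁻¹) • (k₀ q a b c d T₁ T₀ * (Z + Y) * k₀ q a b c d T₁ T₀)
      - k₀ q a b c d T₁ T₀ ^ 2 * (Z + Y) - (Z + Y) * k₀ q a b c d T₁ T₀ ^ 2 =
    constB q a b c d • k₀ q a b c d T₁ T₀ + constC₁ q a b c d • (Z + Y)
      + algebraMap ℂ _ (constD₁ q a b c d)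
      + constE q c d • (k₀ q a b c d T₁ T₀ * (T₁ + algebraMap ℂ _ (a * b)))
      + constF₁ q a b c d • (T₁ + algebraMap ℂ _ (a * b)) := by
  have r₁ := h.k₀_k₁ hq
  have r₂ := h.k₀_kM hq
  generalize k₀ q a b c d T₁ T₀ = K at r₁ r₂ ⊢
  generalize kM q a b c d Z Y T₁ T₀ = M at r₁ r₂ ⊢
  generalize Z + Y = X at r₁ r₂ ⊢
  simp only [sq, mul_assoc, r₁, r₂, mul_assoc_of_eq r₁, mul_add, add_mul, smul_mul_assoc,
    mul_smul_comm, Algebra.algebraMap_eq_smul_one, mul_one, smul_add]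
  match_scalars <;> field_simp <;> ring

theorem T₁_kM (h : IsDAHAQuad q a b c d Z Y T₁ T₀) (hq : q ≠ 0) :
    T₁ * kM q a b c d Z Y T₁ T₀ = kM q a b c d Z Y T₁ T₀ * T₁ := by
  have r₁ := h.T₁_k₀
  have r₂ := h.T₁_k₁
  rw [← sub_eq_iff_eq_add'.2 (h.k₀_k₁ hq)]
  generalize k₀ q a b c d T₁ T₀ = K at r₁ ⊢
  generalize Z + Y = X at r₂ ⊢
  simp only [mul_sub, sub_mul, mul_smul_comm, smul_mul_assoc, mul_assoc, r₁, r₂,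
    mul_assoc_of_eq r₁, mul_assoc_of_eq r₂]

theorem casimir_eq (h : IsDAHAQuad q a b c d Z Y T₁ T₀) (hq : q ≠ 0) :
    casimir q a b c d (k₀ q a b c d T₁ T₀) (Z + Y) T₁ = algebraMap ℂ _ (constQ₀ q a b c d) := by
  have r₁ := h.k₀_k₁ hq
  have r₂ := h.k₀_kM hq
  have r₃ := h.kM_k₁ hq
  have r₄ := h.kM_kM hq
  have r₅ := h.T₁_k₀
  have r₆ := h.T₁_k₁
  have r₇ := h.T₁_kM hq
  rw [casimir, constC₀]
  rw [constC₀] at r₃ r₄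
  generalize k₀ q a b c d T₁ T₀ = K at r₁ r₂ r₃ r₄ r₅ ⊢
  generalize kM q a b c d Z Y T₁ T₀ = M at r₁ r₂ r₃ r₄ r₇ ⊢
  generalize Z + Y = X at r₁ r₂ r₃ r₄ r₆ ⊢
  -- The rules order words as `X`, then `M`, then `K`, then `T₁`, with `M * M` eliminated.
  simp only [sq, mul_assoc, r₁, r₂, r₃, r₄, r₅, r₆, r₇, mul_assoc_of_eq r₁, mul_assoc_of_eq r₂,
    mul_assoc_of_eq r₃, mul_assoc_of_eq r₄, mul_assoc_of_eq r₅, mul_assoc_of_eq r₆,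
    mul_assoc_of_eq r₇,
    mul_add, add_mul, mul_sub, sub_mul, smul_mul_assoc,
    mul_smul_comm, Algebra.algebraMap_eq_smul_one, mul_one, one_mul, smul_add, smul_sub, smul_smul]
  match_scalars <;> field_simp <;> ring

end IsDAHAQuad

/-! ### Commutation rules from the quadratic relations -/

section Relations

variable {A : Type*} [Ring A] [Algebra ℂ A]

theorem mul_self_of_quad {u v : ℂ} {x : A}
    (h : (x + algebraMap ℂ A u) * (x + algebraMap ℂ A v) = 0) :
    x * x = -(u + v) • x - (u * v) • 1 := by
  simp only [mul_add, add_mul, Algebra.algebraMap_eq_smul_one, mul_smul_comm, smul_mul_assoc,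
    mul_one, one_mul] at h
  rw [← sub_eq_zero, ← h]
  module

variable {u r t : ℂ} {T Z Y : A}

/-- Cancelling the last `Z` in the relation for `T * Z` leaves a formula for `T * Z * T`. Since `T *
(T + 1 + u) = -u`, the element `T + 1 + u` is an inverse of `T` up to a scalar; multiplying by it on
the right or on the left removes one factor `T`. -/
theorem mul_eq_of_quad (hu : u ≠ 0) (hr : r ≠ 0) (hT : T * T = -(1 + u) • T - u • 1)
    (hTZ : T * Z * (T * Z) = -t • (T * Z) - (u * r) • 1) (hZY : Z * Y = 1) :
    T * Z = r • (Y * T) + (r * (1 + u)) • Y - t • 1 ∧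
      T * Y = r⁻¹ • (Z * T) - (1 + u) • Y + (r⁻¹ * t) • 1 := by
  have key : T * (Z * T) = -t • T - (u * r) • Y := by
    have := congrArg (· * Y) hTZ
    simpa only [mul_assoc, hZY, mul_one, sub_mul, smul_mul_assoc, one_mul] using this
  constructor
  · have := congrArg (· * (T + (1 + u) • 1)) key
    simp only [mul_assoc, mul_add, hT, sub_mul, smul_mul_assoc, mul_smul_comm, mul_one, mul_sub]
      at this
    refine smul_right_injective A hu ?_
    simp only [smul_add, smul_sub]
    rw [← sub_eq_zero] at this ⊢
    rw [← neg_eq_zero, ← this]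
    module
  · have := congrArg ((T + (1 + u) • 1) * ·) key
    simp only [add_mul, IsDAHAQuad.mul_assoc_of_eq hT, sub_mul, smul_mul_assoc, mul_smul_comm,
      one_mul, mul_sub, hT] at this
    refine smul_right_injective A (mul_ne_zero hu hr) ?_
    simp only [smul_add, smul_sub, smul_smul]
    rw [← sub_eq_zero] at this ⊢
    rw [← this]
    match_scalars <;> field_simp <;> ring

end Relations

variable {q a b c d : ℂ}

theorem DAHA.gen_rel {x y : FreeAlgebra ℂ DAHAGen} (h : DAHARel q a b c d x y) :
    RingQuot.mkAlgHom ℂ (DAHARel q a b c d) x = RingQuot.mkAlgHom ℂ (DAHARel q a b c d) y :=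
  RingQuot.mkAlgHom_rel ℂ h

theorem DAHA.isDAHAQuad (hq : q ≠ 0) (ha : a ≠ 0) (hb : b ≠ 0) (hc : c ≠ 0) (hd : d ≠ 0) :
    IsDAHAQuad q a b c d (gen q a b c d .Z) (gen q a b c d .Zinv) (gen q a b c d .T₁)
      (gen q a b c d .T₀) := by
  have hZY := gen_rel (.Z_mul_Zinv : DAHARel q a b c d _ _)
  have hYZ := gen_rel (.Zinv_mul_Z : DAHARel q a b c d _ _)
  have h₁ := gen_rel (.quad_T₁ : DAHARel q a b c d _ _)
  have h₀ := gen_rel (.quad_T₀ : DAHARel q a b c d _ _)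
  have h₁Z := gen_rel (.quad_T₁Z : DAHARel q a b c d _ _)
  have h₀Y := gen_rel (.quad_T₀Zinv : DAHARel q a b c d _ _)
  simp only [map_mul, map_add, map_one, map_zero, map_smul, AlgHom.commutes]
    at hZY hYZ h₁ h₀ h₁Z h₀Y
  change gen q a b c d .Z * gen q a b c d .Zinv = 1 at hZY
  change gen q a b c d .Zinv * gen q a b c d .Z = 1 at hYZ
  change (gen q a b c d .T₁ + _) * (gen q a b c d .T₁ + 1) = 0 at h₁
  change (gen q a b c d .T₀ + _) * (gen q a b c d .T₀ + 1) = 0 at h₀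
  change (gen q a b c d .T₁ * gen q a b c d .Z + _) * (gen q a b c d .T₁ * gen q a b c d .Z + _) = 0
    at h₁Z
  change (q • (gen q a b c d .T₀ * gen q a b c d .Zinv) + _) *
    (q • (gen q a b c d .T₀ * gen q a b c d .Zinv) + _) = 0 at h₀Y
  generalize gen q a b c d .Z = Z at *
  generalize gen q a b c d .Zinv = Y at *
  generalize gen q a b c d .T₁ = T₁ at *
  generalize gen q a b c d .T₀ = T₀ at *
  have h₁' : T₁ * T₁ = -(1 + a * b) • T₁ - (a * b) • 1 := by
    rw [mul_self_of_quad (u := a * b) (v := 1) (by rwa [map_mul, map_one])]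
    module
  have h₀' : T₀ * T₀ = -(1 + q⁻¹ * c * d) • T₀ - (q⁻¹ * c * d) • 1 := by
    rw [mul_self_of_quad (u := q⁻¹ * c * d) (v := 1)
      (by rwa [map_mul, map_mul, map_one])]
    module
  have e₁ := mul_eq_of_quad (r := 1) (t := a + b) (mul_ne_zero ha hb) one_ne_zero h₁'
    (by rw [mul_self_of_quad h₁Z, mul_one]) hZY
  -- For `T₀` the roles of `Z` and its inverse are exchanged, and dividing the relation by `q ^ 2`
  -- produces the parameters `r` and `t`.
  have e₀ := mul_eq_of_quad (r := q⁻¹) (t := q⁻¹ * (c + d))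
    (mul_ne_zero (mul_ne_zero (inv_ne_zero hq) hc) hd) (inv_ne_zero hq) h₀'
    (by
      have := congrArg ((q⁻¹ ^ 2) • ·) (mul_self_of_quad h₀Y)
      simp only [smul_mul_assoc, mul_smul_comm, smul_smul, smul_sub] at this
      convert this using 1
      · rw [show q⁻¹ ^ 2 * (q * q) = 1 by field_simp, one_smul]
      · match_scalars <;> field_simp) hYZ
  simp only [one_smul, one_mul, inv_one, inv_inv] at e₁ e₀
  refine ⟨hZY, hYZ, h₁', h₀', e₁.1, e₁.2, ?_, ?_⟩
  · rw [e₀.2]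
    match_scalars <;> field_simp
  · rw [e₀.1]

/-! ### The homomorphism and the invertibility of `T₁ * T₀` -/

theorem AWExt.gen_rel {x y : FreeAlgebra ℂ AWGen} (h : AWRel q a b c d x y) :
    RingQuot.mkAlgHom ℂ (AWRel q a b c d) x = RingQuot.mkAlgHom ℂ (AWRel q a b c d) y :=
  RingQuot.mkAlgHom_rel ℂ h

theorem map_casimir {A B : Type*} [Ring A] [Algebra ℂ A] [Ring B] [Algebra ℂ B] (f : A →ₐ[ℂ] B)
    (k₀ k₁ t : A) :
    f (casimir q a b c d k₀ k₁ t) = casimir q a b c d (f k₀) (f k₁) (f t) := by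
  simp only [casimir, map_add, map_mul, map_sub, map_smul, map_pow, AlgHom.commutes]

/-- The values of the homomorphism on the generators. -/
def IsDAHAQuad.genMap (q a b c d : ℂ) {A : Type*} [Ring A] [Algebra ℂ A] (Z Y T₁ T₀ : A) :
    AWGen → A
  | .K₀ => k₀ q a b c d T₁ T₀
  | .K₁ => Z + Y
  | .T₁ => T₁

/-- The homomorphism from the central extension of the Askey-Wilson algebra determined by a
quadruple satisfying the relations of the double affine Hecke algebra. -/
def IsDAHAQuad.lift {A : Type*} [Ring A] [Algebra ℂ A] {Z Y T₁ T₀ : A}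
    (h : IsDAHAQuad q a b c d Z Y T₁ T₀) (hq : q ≠ 0) : AWExt q a b c d →ₐ[ℂ] A :=
  RingQuot.liftAlgHom ℂ ⟨FreeAlgebra.lift ℂ (genMap q a b c d Z Y T₁ T₀), by
    intro x y hxy
    induction hxy with
    | comm_T₁_K₀ => simpa only [map_mul, FreeAlgebra.lift_ι_apply, genMap] using h.T₁_k₀
    | comm_T₁_K₁ => simpa only [map_mul, FreeAlgebra.lift_ι_apply, genMap] using h.T₁_k₁
    | quad_T₁ =>
      rw [Algebra.algebraMap_eq_smul_one]
      simp only [map_mul, map_add, map_one, map_zero, map_smul, FreeAlgebra.lift_ι_apply,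
        genMap, mul_add, add_mul, h.T₁T₁, mul_one, smul_mul_assoc, one_mul]
      module
    | aw₁ =>
      simpa only [map_mul, map_add, map_sub, map_pow, map_smul, AlgHom.commutes,
        FreeAlgebra.lift_ι_apply, genMap] using h.aw₁ hq
    | aw₂ =>
      simpa only [map_mul, map_add, map_sub, map_pow, map_smul, AlgHom.commutes,
        FreeAlgebra.lift_ι_apply, genMap] using h.aw₂ hq
    | casimir_eq =>
      simpa only [map_casimir, AlgHom.commutes, FreeAlgebra.lift_ι_apply, genMap]
        using h.casimir_eq hq⟩

theorem IsDAHAQuad.lift_gen {A : Type*} [Ring A] [Algebra ℂ A] {Z Y T₁ T₀ : A}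
    (h : IsDAHAQuad q a b c d Z Y T₁ T₀) (hq : q ≠ 0) (x : AWGen) :
    h.lift hq (AWExt.gen q a b c d x) = genMap q a b c d Z Y T₁ T₀ x := by
  rw [lift, AWExt.gen, RingQuot.liftAlgHom_mkAlgHom_apply, FreeAlgebra.lift_ι_apply]

/-- By the Hecke relations the two added factors are `-q⁻¹ c d` times the inverse of `T₀` and `-a b`
times the inverse of `T₁`. -/
theorem IsDAHAQuad.mul_adjugate {A : Type*} [Ring A] [Algebra ℂ A] {Z Y T₁ T₀ : A}
    (h : IsDAHAQuad q a b c d Z Y T₁ T₀) :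
    T₁ * T₀ * ((T₀ + (1 + q⁻¹ * c * d) • 1) * (T₁ + (1 + a * b) • 1)) =
      (q⁻¹ * (a * b * c * d)) • 1 ∧
    (T₀ + (1 + q⁻¹ * c * d) • 1) * (T₁ + (1 + a * b) • 1) * (T₁ * T₀) =
      (q⁻¹ * (a * b * c * d)) • 1 := by
  constructor <;>
  · simp only [mul_add, add_mul, mul_assoc, h.T₁T₁, h.T₀T₀, mul_assoc_of_eq h.T₁T₁,
      mul_assoc_of_eq h.T₀T₀, smul_mul_assoc, mul_smul_comm, mul_one, one_mul, mul_sub, sub_mul]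
    module

/-- The unit `T₁ T₀`. -/
def IsDAHAQuad.unit {A : Type*} [Ring A] [Algebra ℂ A] {Z Y T₁ T₀ : A}
    (h : IsDAHAQuad q a b c d Z Y T₁ T₀) (hu : q⁻¹ * (a * b * c * d) ≠ 0) : Aˣ where
  val := T₁ * T₀
  inv := (q⁻¹ * (a * b * c * d))⁻¹ • ((T₀ + (1 + q⁻¹ * c * d) • 1) * (T₁ + (1 + a * b) • 1))
  val_inv := by rw [mul_smul_comm, h.mul_adjugate.1, smul_smul, inv_mul_cancel₀ hu, one_smul]
  inv_val := by rw [smul_mul_assoc, h.mul_adjugate.2, smul_smul, inv_mul_cancel₀ hu, one_smul]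

theorem IsDAHAQuad.k₀_eq {A : Type*} [Ring A] [Algebra ℂ A] {Z Y T₁ T₀ : A}
    (h : IsDAHAQuad q a b c d Z Y T₁ T₀) (hu : q⁻¹ * (a * b * c * d) ≠ 0) :
    k₀ q a b c d T₁ T₀ = (h.unit hu : A) +
      (q⁻¹ * (a * b * c * d)) • (((h.unit hu)⁻¹ : Aˣ) : A) := by
  have : (((h.unit hu)⁻¹ : Aˣ) : A) = (q⁻¹ * (a * b * c * d))⁻¹ •
    ((T₀ + (1 + q⁻¹ * c * d) • 1) * (T₁ + (1 + a * b) • 1)) := rfl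
  rw [this, smul_smul, mul_inv_cancel₀ hu, one_smul]
  change _ = T₁ * T₀ + _
  simp only [k₀, mul_add, add_mul, smul_mul_assoc, mul_smul_comm, mul_one, one_mul]
  module

/-! ### A spanning set of the extended Askey-Wilson algebra -/

section Spanning

variable {A : Type*} [Ring A] [Algebra ℂ A]

/-- The span of the ordered monomials `k₀ ^ n * w * k₁ ^ m` with `w` one of `1`, `t`, `k₁ * k₀`,
`k₁ * k₀ * t`. -/
def monomialSpan (k₀ k₁ t : A) : Submodule ℂ A :=
  Submodule.span ℂ
    {x | ∃ n m : ℕ, ∃ w ∈ ({1, t, k₁ * k₀, k₁ * k₀ * t} : Set A), x = k₀ ^ n * (w * k₁ ^ m)}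

variable {k₀ k₁ t : A}

theorem monomial_mem (n m : ℕ) {w : A} (hw : w ∈ ({1, t, k₁ * k₀, k₁ * k₀ * t} : Set A)) :
    k₀ ^ n * (w * k₁ ^ m) ∈ monomialSpan k₀ k₁ t :=
  Submodule.subset_span ⟨n, m, w, hw, rfl⟩

theorem k₀_mul_mem {x : A} (hx : x ∈ monomialSpan k₀ k₁ t) : k₀ * x ∈ monomialSpan k₀ k₁ t := by
  induction hx using Submodule.span_induction with
  | mem x h =>
    obtain ⟨n, m, w, hw, rfl⟩ := h
    rw [← mul_assoc, ← pow_succ']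
    exact monomial_mem _ _ hw
  | zero => rw [mul_zero]; exact zero_mem _
  | add x y _ _ hx hy => rw [mul_add]; exact add_mem hx hy
  | smul r x _ hx => rw [mul_smul_comm]; exact Submodule.smul_mem _ _ hx

theorem mul_k₁_mem {x : A} (hx : x ∈ monomialSpan k₀ k₁ t) : x * k₁ ∈ monomialSpan k₀ k₁ t := by
  induction hx using Submodule.span_induction with
  | mem x h =>
    obtain ⟨n, m, w, hw, rfl⟩ := h
    rw [mul_assoc, mul_assoc, ← pow_succ]
    exact monomial_mem _ _ hw
  | zero => rw [zero_mul]; exact zero_mem _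
  | add x y _ _ hx hy => rw [add_mul]; exact add_mem hx hy
  | smul r x _ hx => rw [smul_mul_assoc]; exact Submodule.smul_mem _ _ hx

theorem mul_k₁_pow_mem {x : A} (hx : x ∈ monomialSpan k₀ k₁ t) (m : ℕ) :
    x * k₁ ^ m ∈ monomialSpan k₀ k₁ t := by
  induction m with
  | zero => rwa [pow_zero, mul_one]
  | succ m ih => rw [pow_succ, ← mul_assoc]; exact mul_k₁_mem ih

theorem t_mul_mem (h₀ : Commute t k₀) (h₁ : Commute t k₁) {α β : ℂ} (ht : t * t = α • t - β • 1)
    {x : A} (hx : x ∈ monomialSpan k₀ k₁ t) : t * x ∈ monomialSpan k₀ k₁ t := by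
  induction hx using Submodule.span_induction with
  | mem x h =>
    obtain ⟨n, m, w, hw, rfl⟩ := h
    have h₁₀ : Commute t (k₁ * k₀) := h₁.mul_right h₀
    rw [← mul_assoc, (h₀.pow_right n).eq, mul_assoc, ← mul_assoc t]
    rcases hw with rfl | rfl | rfl | rfl
    · rw [mul_one]; exact monomial_mem _ _ (by simp)
    · rw [ht, sub_mul, smul_mul_assoc, smul_mul_assoc, mul_sub, mul_smul_comm, mul_smul_comm]
      exact sub_mem (Submodule.smul_mem _ _ (monomial_mem _ _ (by simp)))
        (Submodule.smul_mem _ _ (monomial_mem _ _ (by simp)))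
    · rw [h₁₀.eq]; exact monomial_mem _ _ (by simp)
    · rw [← mul_assoc t, h₁₀.eq, mul_assoc (k₁ * k₀), ht, mul_sub, mul_smul_comm, mul_smul_comm,
        mul_one, sub_mul, smul_mul_assoc, smul_mul_assoc, mul_sub, mul_smul_comm, mul_smul_comm]
      exact sub_mem (Submodule.smul_mem _ _ (monomial_mem _ _ (by simp)))
        (Submodule.smul_mem _ _ (monomial_mem _ _ (by simp)))
  | zero => rw [mul_zero]; exact zero_mem _
  | add x y _ _ hx hy => rw [mul_add]; exact add_mem hx hy
  | smul r x _ hx => rw [mul_smul_comm]; exact Submodule.smul_mem _ _ hx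

variable {q a b c d : ℂ}

/-- The second cubic relation, solved for `k₁ * k₀ ^ 2`, is a two-step recursion in the exponent of
`k₀`; only the exponents 0 and 1 need separate input. -/
theorem k₁_mul_k₀_pow_mul_mem (h₀ : Commute t k₀) (h₁ : Commute t k₁) {α β : ℂ}
    (ht : t * t = α • t - β • 1)
    (aw₂ : (q + q⁻¹) • (k₀ * k₁ * k₀) - k₀ ^ 2 * k₁ - k₁ * k₀ ^ 2 =
      constB q a b c d • k₀ + constC₁ q a b c d • k₁ + algebraMap ℂ _ (constD₁ q a b c d)
        + constE q c d • (k₀ * (t + algebraMap ℂ _ (a * b)))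
        + constF₁ q a b c d • (t + algebraMap ℂ _ (a * b)))
    {w : A} (hw : w ∈ monomialSpan k₀ k₁ t) (hw₁ : k₁ * w ∈ monomialSpan k₀ k₁ t)
    (hw₂ : k₁ * (k₀ * w) ∈ monomialSpan k₀ k₁ t) (n : ℕ) :
    k₁ * (k₀ ^ n * w) ∈ monomialSpan k₀ k₁ t := by
  have hV (n : ℕ) : k₀ ^ n * w ∈ monomialSpan k₀ k₁ t := by
    induction n with
    | zero => rwa [pow_zero, one_mul]
    | succ n ih => rw [pow_succ', mul_assoc]; exact k₀_mul_mem ih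
  induction n using Nat.twoStepInduction with
  | zero => rwa [pow_zero, one_mul]
  | one => rwa [pow_one]
  | more n ih₀ ih₁ =>
    have key := congrArg (· * (k₀ ^ n * w)) aw₂
    simp only [Algebra.algebraMap_eq_smul_one, sq, sub_mul, add_mul, mul_add, mul_one,
      smul_mul_assoc, mul_smul_comm, mul_assoc, one_mul, smul_add, smul_smul] at key
    have e : k₁ * (k₀ ^ (n + 2) * w) = (q + q⁻¹) • (k₀ * (k₁ * (k₀ ^ (n + 1) * w)))
        - k₀ * (k₀ * (k₁ * (k₀ ^ n * w))) - constB q a b c d • (k₀ * (k₀ ^ n * w))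
        - constC₁ q a b c d • (k₁ * (k₀ ^ n * w)) - constD₁ q a b c d • (k₀ ^ n * w)
        - constE q c d • (k₀ * (t * (k₀ ^ n * w)))
        - (constE q c d * (a * b)) • (k₀ * (k₀ ^ n * w))
        - constF₁ q a b c d • (t * (k₀ ^ n * w))
        - (constF₁ q a b c d * (a * b)) • (k₀ ^ n * w) := by
      simp only [pow_succ', mul_assoc]
      rw [← sub_eq_zero] at key ⊢
      rw [← neg_eq_zero, ← key]
      module
    rw [e]
    refine sub_mem (sub_mem (sub_mem (sub_mem (sub_mem (sub_mem (sub_mem (sub_mem ?_ ?_) ?_) ?_)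
      ?_) ?_) ?_) ?_) ?_ <;> try apply Submodule.smul_mem
    · exact k₀_mul_mem ih₁
    · exact k₀_mul_mem (k₀_mul_mem ih₀)
    · exact k₀_mul_mem (hV n)
    · exact ih₀
    · exact hV n
    · exact k₀_mul_mem (t_mul_mem h₀ h₁ ht (hV n))
    · exact k₀_mul_mem (hV n)
    · exact t_mul_mem h₀ h₁ ht (hV n)
    · exact hV n

theorem k₁_mul_mem (h₀ : Commute t k₀) (h₁ : Commute t k₁) {α β : ℂ}
    (ht : t * t = α • t - β • 1)
    (aw₁ : (q + q⁻¹) • (k₁ * k₀ * k₁) - k₁ ^ 2 * k₀ - k₀ * k₁ ^ 2 =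
      constB q a b c d • k₁ + constC₀ q • k₀ + algebraMap ℂ _ (constD₀ q a b c d)
        + constE q c d • (k₁ * (t + algebraMap ℂ _ (a * b)))
        + constF₀ q c d • (t + algebraMap ℂ _ (a * b)))
    (aw₂ : (q + q⁻¹) • (k₀ * k₁ * k₀) - k₀ ^ 2 * k₁ - k₁ * k₀ ^ 2 =
      constB q a b c d • k₀ + constC₁ q a b c d • k₁ + algebraMap ℂ _ (constD₁ q a b c d)
        + constE q c d • (k₀ * (t + algebraMap ℂ _ (a * b)))
        + constF₁ q a b c d • (t + algebraMap ℂ _ (a * b)))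
    (hc : casimir q a b c d k₀ k₁ t = algebraMap ℂ _ (constQ₀ q a b c d))
    {x : A} (hx : x ∈ monomialSpan k₀ k₁ t) : k₁ * x ∈ monomialSpan k₀ k₁ t := by
  have m₁ : (1 : A) ∈ monomialSpan k₀ k₁ t := by
    simpa using monomial_mem (k₀ := k₀) (k₁ := k₁) (t := t) 0 0 (w := 1) (by simp)
  have mk₁ : k₁ ∈ monomialSpan k₀ k₁ t := by simpa using mul_k₁_mem m₁
  have mk₀ : k₀ ∈ monomialSpan k₀ k₁ t := by simpa using k₀_mul_mem m₁
  have mk₁₀ : k₁ * k₀ ∈ monomialSpan k₀ k₁ t := by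
    simpa using monomial_mem (k₀ := k₀) (k₁ := k₁) (t := t) 0 0 (w := k₁ * k₀) (by simp)
  have mt {x : A} (hx : x ∈ monomialSpan k₀ k₁ t) := t_mul_mem h₀ h₁ ht hx
  -- The first cubic relation expresses `k₁ ^ 2 * k₀` through ordered words.
  have m₁₁₀ : k₁ * (k₁ * k₀) ∈ monomialSpan k₀ k₁ t := by
    have e : k₁ * (k₁ * k₀) = (q + q⁻¹) • (k₁ * k₀ * k₁) - k₀ * k₁ * k₁
        - constB q a b c d • k₁ - constC₀ q • k₀ - constD₀ q a b c d • 1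
        - constE q c d • (t * k₁) - (constE q c d * (a * b)) • k₁ - constF₀ q c d • (t * 1)
        - (constF₀ q c d * (a * b)) • 1 := by
      simp only [Algebra.algebraMap_eq_smul_one, sq, mul_add, mul_one, mul_smul_comm, mul_assoc,
        ← h₁.eq] at aw₁ ⊢
      rw [← sub_eq_zero] at aw₁ ⊢
      rw [← neg_eq_zero, ← aw₁]
      module
    rw [e]
    refine sub_mem (sub_mem (sub_mem (sub_mem (sub_mem (sub_mem (sub_mem (sub_mem ?_ ?_) ?_) ?_)
      ?_) ?_) ?_) ?_) ?_ <;> try apply Submodule.smul_mem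
    · exact mul_k₁_mem mk₁₀
    · exact mul_k₁_mem (k₀_mul_mem mk₁)
    · exact mk₁
    · exact mk₀
    · exact m₁
    · exact mt mk₁
    · exact mk₁
    · exact mt m₁
    · exact m₁
  -- The Casimir relation contains `(k₁ * k₀) ^ 2` with coefficient 1, which bounds the number of
  -- factors `k₁ * k₀` in an ordered word by one.
  have m₁₀₁₀ : k₁ * (k₀ * (k₁ * k₀)) ∈ monomialSpan k₀ k₁ t := by
    have e : k₁ * (k₀ * (k₁ * k₀)) = (q ^ 2 + 1 + q⁻¹ ^ 2) • (k₀ * (k₁ * k₀ * k₁))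
        - (q + q⁻¹) • (k₀ * (k₀ * (k₁ * k₁)))
        - (q + q⁻¹) • (constC₀ q • (k₀ * k₀) + constC₁ q a b c d • (k₁ * k₁))
        - constB q a b c d • ((q + 1 + q⁻¹) • (k₀ * k₁) + k₁ * k₀)
        - constE q c d • (t * ((q + 1 + q⁻¹) • (k₀ * k₁) + k₁ * k₀))
        - (constE q c d * (a * b)) • ((q + 1 + q⁻¹) • (k₀ * k₁) + k₁ * k₀)
        - (q + 1 + q⁻¹) • (constD₀ q a b c d • k₀ + constF₀ q c d • (t * k₀)
            + (constF₀ q c d * (a * b)) • k₀)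
        - (q + 1 + q⁻¹) • (constD₁ q a b c d • k₁ + constF₁ q a b c d • (t * k₁)
            + (constF₁ q a b c d * (a * b)) • k₁)
        - constG q a b c d • (t * 1) - (constG q a b c d * (a * b)) • 1
        + constQ₀ q a b c d • 1 := by
      simp only [casimir, Algebra.algebraMap_eq_smul_one, sq, mul_add, add_mul, mul_one,
        mul_smul_comm, smul_mul_assoc, mul_assoc, one_mul] at hc ⊢
      rw [← sub_eq_zero] at hc ⊢
      rw [← hc]
      module
    rw [e]
    have hk : (q + 1 + q⁻¹) • (k₀ * k₁) + k₁ * k₀ ∈ monomialSpan k₀ k₁ t :=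
      add_mem (Submodule.smul_mem _ _ (k₀_mul_mem mk₁)) mk₁₀
    refine add_mem (sub_mem (sub_mem (sub_mem (sub_mem (sub_mem (sub_mem (sub_mem (sub_mem (sub_mem
      ?_ ?_) ?_) ?_) ?_) ?_) ?_) ?_) ?_) ?_) ?_ <;> apply Submodule.smul_mem
    · exact k₀_mul_mem (mul_k₁_mem mk₁₀)
    · exact k₀_mul_mem (k₀_mul_mem (mul_k₁_mem mk₁))
    · exact add_mem (Submodule.smul_mem _ _ (k₀_mul_mem mk₀))
        (Submodule.smul_mem _ _ (mul_k₁_mem mk₁))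
    · exact hk
    · exact mt hk
    · exact hk
    · exact add_mem (add_mem (Submodule.smul_mem _ _ mk₀) (Submodule.smul_mem _ _ (mt mk₀)))
        (Submodule.smul_mem _ _ mk₀)
    · exact add_mem (add_mem (Submodule.smul_mem _ _ mk₁) (Submodule.smul_mem _ _ (mt mk₁)))
        (Submodule.smul_mem _ _ mk₁)
    · exact mt m₁
    · exact m₁
    · exact m₁
  have g₁ (n : ℕ) : k₁ * (k₀ ^ n * 1) ∈ monomialSpan k₀ k₁ t :=
    k₁_mul_k₀_pow_mul_mem h₀ h₁ ht aw₂ m₁ (by rwa [mul_one]) (by rwa [mul_one]) n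
  have g₁₀ (n : ℕ) : k₁ * (k₀ ^ n * (k₁ * k₀)) ∈ monomialSpan k₀ k₁ t :=
    k₁_mul_k₀_pow_mul_mem h₀ h₁ ht aw₂ mk₁₀ m₁₁₀ m₁₀₁₀ n
  have ct (n : ℕ) {w : A} (hw : Commute t w) :
      k₁ * (k₀ ^ n * (w * t)) = t * (k₁ * (k₀ ^ n * w)) := by
    rw [← mul_assoc, ← mul_assoc, ← ((h₁.mul_right (h₀.pow_right n)).mul_right hw).eq, mul_assoc k₁]
  induction hx using Submodule.span_induction with
  | mem x h =>
    obtain ⟨n, m, w, hw, rfl⟩ := h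
    rw [← mul_assoc (k₀ ^ n), ← mul_assoc]
    refine mul_k₁_pow_mem ?_ m
    rcases hw with rfl | rfl | rfl | rfl
    · exact g₁ n
    · have := ct n (Commute.one_right w)
      rw [one_mul] at this
      rw [this]
      exact mt (g₁ n)
    · exact g₁₀ n
    · rw [ct n (h₁.mul_right h₀)]
      exact mt (g₁₀ n)
  | zero => rw [mul_zero]; exact zero_mem _
  | add x y _ _ hx hy => rw [mul_add]; exact add_mem hx hy
  | smul r x _ hx => rw [mul_smul_comm]; exact Submodule.smul_mem _ _ hx

end Spanning

theorem AWExt.monomialSpan_eq_top (q a b c d : ℂ) :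
    monomialSpan (gen q a b c d .K₀) (gen q a b c d .K₁) (gen q a b c d .T₁) = ⊤ := by
  have h₀ := gen_rel (.comm_T₁_K₀ : AWRel q a b c d _ _)
  have h₁ := gen_rel (.comm_T₁_K₁ : AWRel q a b c d _ _)
  have ht := gen_rel (.quad_T₁ : AWRel q a b c d _ _)
  have aw₁ := gen_rel (.aw₁ : AWRel q a b c d _ _)
  have aw₂ := gen_rel (.aw₂ : AWRel q a b c d _ _)
  have hc := gen_rel (.casimir_eq : AWRel q a b c d _ _)
  rw [map_casimir, AlgHom.commutes] at hc
  rw [map_mul, map_mul] at h₀ h₁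
  rw [Algebra.algebraMap_eq_smul_one] at ht
  simp only [Algebra.algebraMap_eq_smul_one (A := FreeAlgebra ℂ AWGen)] at aw₁ aw₂
  simp only [map_mul, map_add, map_one, map_zero, map_smul, map_pow, map_sub] at ht aw₁ aw₂
  simp only [← Algebra.algebraMap_eq_smul_one] at ht aw₁ aw₂
  replace ht := mul_self_of_quad (u := a * b) (v := 1) (x := gen q a b c d .T₁)
    (by rw [map_one]; exact ht)
  refine Submodule.eq_top_iff'.2 fun x => ?_
  -- It is enough that the span is a left ideal, since it contains 1.
  suffices h : ∀ y, y ∈ monomialSpan (gen q a b c d .K₀) (gen q a b c d .K₁) (gen q a b c d .T₁) →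
      x * y ∈ monomialSpan (gen q a b c d .K₀) (gen q a b c d .K₁) (gen q a b c d .T₁) by
    rw [← mul_one x]
    refine h 1 ?_
    simpa using monomial_mem (k₀ := gen q a b c d .K₀) (k₁ := gen q a b c d .K₁)
      (t := gen q a b c d .T₁) 0 0 (w := 1) (by simp)
  obtain ⟨x, rfl⟩ := RingQuot.mkAlgHom_surjective ℂ (AWRel q a b c d) x
  induction x using FreeAlgebra.induction with
  | grade0 r =>
    intro y hy
    rw [AlgHom.commutes, Algebra.algebraMap_eq_smul_one, smul_mul_assoc, one_mul]
    exact Submodule.smul_mem _ _ hy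
  | grade1 x =>
    intro y hy
    cases x with
    | K₀ => exact k₀_mul_mem hy
    | K₁ => exact k₁_mul_mem h₀ h₁ ht aw₁ aw₂ hc hy
    | T₁ => exact t_mul_mem h₀ h₁ ht hy
  | mul x y hx hy =>
    intro z hz
    rw [map_mul, mul_assoc]
    exact hx _ (hy _ hz)
  | add x y hx hy =>
    intro z hz
    rw [map_add, add_mul]
    exact add_mem (hx _ hz) (hy _ hz)

/-! ### The representation by q-difference-reflection operators -/

section Representation

/-- The diagonal operator with entries `u` and `v` on the two components. -/
def diagOp (u v : ℤ → ℂ) : Module.End ℂ (ℤ → ℂ × ℂ) where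
  toFun f j := (u j * (f j).1, v j * (f j).2)
  map_add' f g := by ext j <;> simp [mul_add]
  map_smul' r f := by ext j <;> simp [mul_left_comm]

/-- The operator acting by two by two matrices on the pairs `(f j).1, (f j).2`; its lower left
entries are `1`. -/
def withinOp (u v : ℤ → ℂ) (r : ℂ) : Module.End ℂ (ℤ → ℂ × ℂ) where
  toFun f j := (u j * (f j).1 + (u j * v j - r) * (f j).2, (f j).1 + v j * (f j).2)
  map_add' f g := by ext j <;> simp <;> ring
  map_smul' r f := by ext j <;> simp <;> ring

/-- The operator acting by two by two matrices on the pairs `(f j).2, (f (j + 1)).1`; its lower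
left entries are `1`. -/
def acrossOp (u v : ℤ → ℂ) (r : ℂ) : Module.End ℂ (ℤ → ℂ × ℂ) where
  toFun f j := ((f (j - 1)).2 + v j * (f j).1,
    u j * (f j).2 + (u j * v (j + 1) - r) * (f (j + 1)).1)
  map_add' f g := by ext j <;> simp <;> ring
  map_smul' r f := by ext j <;> simp <;> ring

/-- The points at which functions are evaluated. -/
def pt (q w : ℂ) (j : ℤ) : ℂ := w * q ^ j

theorem pt_add_one {q : ℂ} (hq : q ≠ 0) (w : ℂ) (j : ℤ) : pt q w (j + 1) = q * pt q w j := by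
  rw [pt, pt, zpow_add_one₀ hq]; ring

variable (q a b c d w : ℂ)

/-- The images of the generators under the representation of the double affine Hecke algebra by
`q`-difference-reflection operators on the orbit of `w`. -/
def repGen : DAHAGen → Module.End ℂ (ℤ → ℂ × ℂ)
  | .Z => diagOp (pt q w) (fun j => (pt q w j)⁻¹)
  | .Zinv => diagOp (fun j => (pt q w j)⁻¹) (pt q w)
  | .T₁ => withinOp (fun j => ((1 + a * b) - (a + b) * pt q w j) / (pt q w j ^ 2 - 1))
      (fun j => (-(1 + a * b) * pt q w j ^ 2 + (a + b) * pt q w j) / (pt q w j ^ 2 - 1)) (a * b)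
  | .T₀ => acrossOp
      (fun j => ((1 + q⁻¹ * c * d) - (c + d) * pt q w j) / (q * pt q w j ^ 2 - 1))
      (fun j => ((1 + q⁻¹ * c * d) * pt q w j ^ 2 - (c + d) * pt q w j) / (q - pt q w j ^ 2))
      (q⁻¹ * c * d)

variable {q a b c d w}

/-- Each quadratic relation is Cayley-Hamilton for two by two blocks. In `withinOp` and `acrossOp`
the blocks have determinant `r`, and the diagonal entries are the ones for which both the block and
its product with the diagonal block of `Z` (for `T₀`, of `Zinv`) have the prescribed trace. The
condition on `w` keeps the denominators nonzero. -/
theorem repGen_rel (hq : q ≠ 0) (hw : w ≠ 0) (hqw : ∀ n : ℤ, w ^ 2 * q ^ n ≠ 1)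
    {x y : FreeAlgebra ℂ DAHAGen} (h : DAHARel q a b c d x y) :
    FreeAlgebra.lift ℂ (repGen q a b c d w) x = FreeAlgebra.lift ℂ (repGen q a b c d w) y := by
  have h₀ (j : ℤ) : pt q w j ≠ 0 := mul_ne_zero hw (zpow_ne_zero _ hq)
  have h₁ (j : ℤ) : pt q w j ^ 2 - 1 ≠ 0 := by
    have := hqw (j + j)
    rwa [zpow_add₀ hq, ← sq, ← mul_pow, ← sub_ne_zero] at this
  have h₂ (j : ℤ) : q * pt q w j ^ 2 - 1 ≠ 0 := by
    have := hqw (j + j + 1)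
    rwa [zpow_add_one₀ hq, zpow_add₀ hq, ← sq, ← mul_assoc, ← mul_pow, mul_comm, ← sub_ne_zero]
      at this
  -- A block of `T₀` joins the indices `j` and `j + 1`. This puts its second diagonal entry,
  -- computed at the point `q * s`, over the same denominator as the first, computed at `s`.
  have hv {s : ℂ} (hs : q * s ^ 2 - 1 ≠ 0) :
      ((1 + q⁻¹ * c * d) * (q ^ 2 * s ^ 2) - (c + d) * (q * s)) / (q - q ^ 2 * s ^ 2) =
        (-(1 + q⁻¹ * c * d) * (q * s ^ 2) + (c + d) * s) / (q * s ^ 2 - 1) := by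
    have hs' : q - q ^ 2 * s ^ 2 ≠ 0 := by
      rw [← neg_ne_zero]; convert mul_ne_zero hq hs using 1; ring
    rw [div_eq_div_iff hs' hs]
    ring
  induction h with
  | Z_mul_Zinv =>
    simp only [map_mul, map_one, FreeAlgebra.lift_ι_apply]
    refine LinearMap.ext fun f => funext fun j => ?_
    simp [repGen, diagOp, h₀]
  | Zinv_mul_Z =>
    simp only [map_mul, map_one, FreeAlgebra.lift_ι_apply]
    refine LinearMap.ext fun f => funext fun j => ?_
    simp [repGen, diagOp, h₀]
  | quad_T₁ =>
    simp only [map_mul, map_zero, map_add, AlgHom.commutes, FreeAlgebra.lift_ι_apply]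
    refine LinearMap.ext fun f => funext fun j => ?_
    have := h₁ j
    ext <;> simp [repGen, withinOp, Algebra.algebraMap_eq_smul_one] <;> field_simp <;> ring
  | quad_T₁Z =>
    simp only [map_mul, map_zero, map_add, AlgHom.commutes, FreeAlgebra.lift_ι_apply]
    refine LinearMap.ext fun f => funext fun j => ?_
    have := h₁ j
    have := h₀ j
    ext <;> simp [repGen, withinOp, diagOp, Algebra.algebraMap_eq_smul_one] <;> field_simp <;> ring
  | quad_T₀ =>
    simp only [map_mul, map_zero, map_add, AlgHom.commutes, FreeAlgebra.lift_ι_apply]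
    refine LinearMap.ext fun f => funext fun j => ?_
    have e₁ := h₂ (j - 1)
    have e₂ := h₂ j
    have e₅ := pt_add_one hq w j
    have e₆ := pt_add_one hq w (j - 1)
    rw [sub_add_cancel] at e₆
    ext
    · simp [repGen, acrossOp, Algebra.algebraMap_eq_smul_one, e₆, mul_pow, hv e₁]
      generalize pt q w (j - 1) = s at *
      field_simp
      ring
    · simp [repGen, acrossOp, Algebra.algebraMap_eq_smul_one, e₅, mul_pow, hv e₂]
      generalize pt q w j = s at *
      field_simp
      ring
  | quad_T₀Zinv =>
    simp only [map_mul, map_zero, map_add, map_smul, AlgHom.commutes,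
      FreeAlgebra.lift_ι_apply]
    refine LinearMap.ext fun f => funext fun j => ?_
    have e₀ := h₀ (j - 1)
    have e₃ := h₀ j
    have e₁ := h₂ (j - 1)
    have e₂ := h₂ j
    have e₅ := pt_add_one hq w j
    have e₆ := pt_add_one hq w (j - 1)
    rw [sub_add_cancel] at e₆
    ext
    · simp [repGen, acrossOp, diagOp, Algebra.algebraMap_eq_smul_one, e₆, mul_pow, hv e₁]
      generalize pt q w (j - 1) = s at *
      field_simp
      ring
    · simp [repGen, acrossOp, diagOp, Algebra.algebraMap_eq_smul_one, e₅, mul_pow, hv e₂]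
      generalize pt q w j = s at *
      field_simp
      ring

end Representation

/-! ### Polynomials in `t + t⁻¹` -/

section Independence

open Polynomial

theorem exists_eval_eq_pow_mul_eval (p : ℂ[X]) :
    ∃ (P : ℂ[X]) (n : ℕ), ∀ t : ℂ, t ≠ 0 → P.eval t = t ^ n * p.eval (t + t⁻¹) := by
  induction p using Polynomial.induction_on with
  | C r => exact ⟨C r, 0, fun t _ => by simp⟩
  | add p₁ p₂ h₁ h₂ =>
    obtain ⟨P₁, n₁, h₁⟩ := h₁
    obtain ⟨P₂, n₂, h₂⟩ := h₂
    refine ⟨X ^ n₂ * P₁ + X ^ n₁ * P₂, n₁ + n₂, fun t ht => ?_⟩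
    simp only [eval_add, eval_mul, eval_pow, eval_X, h₁ t ht, h₂ t ht]
    ring
  | monomial n r h =>
    obtain ⟨P, m, h⟩ := h
    refine ⟨(X ^ 2 + 1) * P, m + 1, fun t ht => ?_⟩
    have e : t ^ 2 + 1 = t * (t + t⁻¹) := by field_simp
    simp only [eval_add, eval_mul, eval_pow, eval_X, eval_one, h t ht, eval_C, e]
    ring

/-- Every `x` other than 2 and -2 equals `t + t⁻¹` for a root `t` of `t ^ 2 - x t + 1`, and then `t
^ 2 ≠ 1`; so the polynomial has infinitely many roots. -/
theorem eq_zero_of_eval_joukowski_eq_zero {p : ℂ[X]}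
    (h : ∀ t : ℂ, t ≠ 0 → t ^ 2 ≠ 1 → p.eval (t + t⁻¹) = 0) : p = 0 := by
  refine Polynomial.eq_zero_of_infinite_isRoot p (Set.Infinite.mono (s := {2, -2}ᶜ) ?_
    (Set.Finite.infinite_compl (by simp)))
  intro x hx
  obtain ⟨s, hs⟩ := IsAlgClosed.exists_pow_nat_eq (x ^ 2 - 4) (n := 2) (by norm_num)
  have h₀ : (x + s) / 2 * ((x - s) / 2) = 1 := by linear_combination -hs / 4
  have h₁ : (x + s) / 2 ≠ 0 := left_ne_zero_of_mul_eq_one h₀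
  have h₂ : ((x + s) / 2)⁻¹ = (x - s) / 2 := (eq_inv_of_mul_eq_one_right h₀).symm
  have h₃ := h _ h₁ fun h₃ => by
    have : s = 0 := by
      have : (x + s) / 2 = (x - s) / 2 := by
        rw [← mul_right_inj' h₁, h₀, ← sq, h₃]
      linear_combination this
    rw [this] at hs
    have : (x - 2) * (x + 2) = 0 := by linear_combination -hs
    rcases mul_eq_zero.1 this with h | h
    · exact hx (Or.inl (by linear_combination h))
    · exact hx (Or.inr (by rw [Set.mem_singleton_iff]; linear_combination h))
  rw [h₂] at h₃
  rwa [← add_div, add_add_sub_cancel, add_self_div_two] at h₃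

/-- After clearing denominators, the identity extends from the infinite set to all nonzero `t`,
where it can be compared with its image under `t ↦ t⁻¹`. -/
theorem eq_zero_of_eval_add_eq_zero {q : ℂ} (hq : q ≠ 0) (hq₂ : q ^ 2 ≠ 1) {S : Set ℂ}
    (hS : S.Infinite) (hS₀ : ∀ t ∈ S, t ≠ 0) {p r : ℂ[X]}
    (h : ∀ t ∈ S, p.eval (t + t⁻¹) + (q * t + (q * t)⁻¹) * r.eval (t + t⁻¹) = 0) :
    p = 0 ∧ r = 0 := by
  obtain ⟨P, m, hP⟩ := exists_eval_eq_pow_mul_eval p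
  obtain ⟨R, n, hR⟩ := exists_eval_eq_pow_mul_eval r
  have hΦ : C q * X ^ (n + 1) * P + (C (q ^ 2) * X ^ 2 + 1) * (X ^ m * R) = 0 := by
    refine Polynomial.eq_zero_of_infinite_isRoot _ (hS.mono fun t ht => ?_)
    have h₀ := hS₀ t ht
    have e : q ^ 2 * t ^ 2 + 1 = q * t * (q * t + (q * t)⁻¹) := by field_simp
    simp only [Set.mem_ofPred_eq, IsRoot, eval_add, eval_mul, eval_pow, eval_X, eval_one, eval_C,
      hP t h₀, hR t h₀, e]
    linear_combination q * t ^ (n + 1 + m) * h t ht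
  have key (t : ℂ) (h₀ : t ≠ 0) :
      p.eval (t + t⁻¹) + (q * t + (q * t)⁻¹) * r.eval (t + t⁻¹) = 0 := by
    have e : q ^ 2 * t ^ 2 + 1 = q * t * (q * t + (q * t)⁻¹) := by field_simp
    have := congrArg (eval t) hΦ
    simp only [eval_add, eval_mul, eval_pow, eval_X, eval_one, eval_C, eval_zero,
      hP t h₀, hR t h₀, e] at this
    have h₁ : q * t ^ (n + 1 + m) ≠ 0 := mul_ne_zero hq (pow_ne_zero _ h₀)
    rw [← mul_right_inj' h₁, mul_zero, ← this]
    ring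
  have hr : r = 0 := by
    refine eq_zero_of_eval_joukowski_eq_zero fun t h₀ h₁ => ?_
    -- The inversion fixes `t + t⁻¹`, so subtracting leaves `(q - q⁻¹) * (t - t⁻¹)` times the value
    -- of `r`.
    have e := key t⁻¹ (inv_ne_zero h₀)
    rw [inv_inv, add_comm t⁻¹] at e
    have e' : (q ^ 2 - 1) * (t ^ 2 - 1) * r.eval (t + t⁻¹) = 0 := by
      have e₁ := key t h₀
      generalize t + t⁻¹ = x at e e₁ ⊢
      simp only [mul_inv, inv_inv] at e e₁
      have := e₁.trans e.symm
      field_simp at this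
      linear_combination this
    exact (mul_eq_zero.1 e').resolve_left
      (mul_ne_zero (sub_ne_zero.2 hq₂) (sub_ne_zero.2 h₁))
  refine ⟨eq_zero_of_eval_joukowski_eq_zero fun t h₀ _ => ?_, hr⟩
  simpa [hr] using key t h₀

end Independence

/-! ### Leading terms in `k₀` and linear independence -/

section Independence

open Polynomial

variable {A : Type*} [Ring A] [Algebra ℂ A]

/-- The ordered expression `∑ k₀ ^ n P n (k₁) + ∑ k₀ ^ n (k₁ k₀) R n (k₁)`. -/
def orderedSum (k₀ k₁ : A) (P R : ℕ → ℂ[X]) (N : ℕ) : A :=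
  ∑ n ∈ Finset.range (N + 1), k₀ ^ n * aeval k₁ (P n) +
    ∑ n ∈ Finset.range N, k₀ ^ n * (k₁ * k₀) * aeval k₁ (R n)

theorem orderedSum_zero (k₀ k₁ : A) (P R : ℕ → ℂ[X]) :
    orderedSum k₀ k₁ P R 0 = aeval k₁ (P 0) := by
  simp [orderedSum]

/-- The word `k₀ ^ N * (k₁ * k₀)` has degree `N + 1` in `k₀`; hence the sum over `R` is one term
shorter and is split off together with `P (N + 1)`. -/
theorem orderedSum_succ (k₀ k₁ : A) (P R : ℕ → ℂ[X]) (N : ℕ) :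
    orderedSum k₀ k₁ P R (N + 1) = orderedSum k₀ k₁ P R N +
      (k₀ ^ (N + 1) * aeval k₁ (P (N + 1)) + k₀ ^ N * (k₁ * k₀) * aeval k₁ (R N)) := by
  rw [orderedSum, orderedSum, Finset.sum_range_succ _ (N + 1),
    Finset.sum_range_succ (fun n => k₀ ^ n * (k₁ * k₀) * aeval k₁ (R n)) N]
  abel

theorem map_orderedSum {B : Type*} [Ring B] [Algebra ℂ B] (f : A →ₐ[ℂ] B) (k₀ k₁ : A)
    (P R : ℕ → ℂ[X]) (N : ℕ) :
    f (orderedSum k₀ k₁ P R N) = orderedSum (f k₀) (f k₁) P R N := by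
  simp only [orderedSum, map_add, map_sum, map_mul, map_pow, aeval_algHom_apply]

/-- The linear map sending a family `P` of polynomials to `∑ k₀ ^ n * w * P n (k₁)`. -/
def orderedLin (k₀ k₁ w : A) : (ℕ →₀ ℂ[X]) →ₗ[ℂ] A :=
  Finsupp.lsum ℂ fun n => LinearMap.mulLeft ℂ (k₀ ^ n * w) ∘ₗ (aeval k₁).toLinearMap

theorem orderedLin_single (k₀ k₁ w : A) (n m : ℕ) :
    orderedLin k₀ k₁ w (Finsupp.single n (X ^ m)) = k₀ ^ n * w * k₁ ^ m := by
  simp [orderedLin, mul_assoc]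

theorem orderedLin_eq_sum (k₀ k₁ w : A) (P : ℕ →₀ ℂ[X]) {N : ℕ}
    (hN : P.support ⊆ Finset.range N) :
    orderedLin k₀ k₁ w P = ∑ n ∈ Finset.range N, k₀ ^ n * w * aeval k₁ (P n) := by
  rw [orderedLin, Finsupp.lsum_apply, Finsupp.sum_of_support_subset _ hN _ (by simp)]
  simp [mul_assoc]

theorem exists_orderedLin_of_mem {k₀ k₁ t x : A} (h₀ : Commute t k₀) (h₁ : Commute t k₁)
    (hx : x ∈ monomialSpan k₀ k₁ t) :
    ∃ P R P' R' : ℕ →₀ ℂ[X], x = orderedLin k₀ k₁ 1 P + orderedLin k₀ k₁ (k₁ * k₀) R +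
      (orderedLin k₀ k₁ 1 P' + orderedLin k₀ k₁ (k₁ * k₀) R') * t := by
  induction hx using Submodule.span_induction with
  | mem x h =>
    obtain ⟨n, m, w, hw, rfl⟩ := h
    have hm := h₁.pow_right m
    rcases hw with rfl | rfl | rfl | rfl
    · exact ⟨Finsupp.single n (X ^ m), 0, 0, 0, by simp [orderedLin_single]⟩
    · exact ⟨0, 0, Finsupp.single n (X ^ m), 0, by simp [orderedLin_single, hm.eq, mul_assoc]⟩
    · exact ⟨0, Finsupp.single n (X ^ m), 0, 0, by simp [orderedLin_single, mul_assoc]⟩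
    · exact ⟨0, 0, 0, Finsupp.single n (X ^ m), by simp [orderedLin_single, hm.eq, mul_assoc]⟩
  | zero => exact ⟨0, 0, 0, 0, by simp⟩
  | add x y _ _ hx hy =>
    obtain ⟨P₁, R₁, P₁', R₁', rfl⟩ := hx
    obtain ⟨P₂, R₂, P₂', R₂', rfl⟩ := hy
    refine ⟨P₁ + P₂, R₁ + R₂, P₁' + P₂', R₁' + R₂', ?_⟩
    simp only [map_add, add_mul]
    abel
  | smul r x _ hx =>
    obtain ⟨P, R, P', R', rfl⟩ := hx
    refine ⟨r • P, r • R, r • P', r • R', ?_⟩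
    simp only [map_smul, smul_add, add_mul, smul_mul_assoc]

theorem exists_orderedSum_of_mem {k₀ k₁ t x : A} (h₀ : Commute t k₀) (h₁ : Commute t k₁)
    (hx : x ∈ monomialSpan k₀ k₁ t) :
    ∃ (N : ℕ) (P R P' R' : ℕ → ℂ[X]),
      x = orderedSum k₀ k₁ P R N + orderedSum k₀ k₁ P' R' N * t := by
  obtain ⟨P, R, P', R', rfl⟩ := exists_orderedLin_of_mem h₀ h₁ hx
  obtain ⟨N, hN⟩ := (P.support ∪ R.support ∪ (P'.support ∪ R'.support)).exists_nat_subset_range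
  have h₁ : Finset.range N ⊆ Finset.range (N + 1) := Finset.range_mono N.le_succ
  simp only [Finset.union_subset_iff] at hN
  refine ⟨N, P, R, P', R', ?_⟩
  rw [orderedLin_eq_sum _ _ _ _ (hN.1.1.trans h₁), orderedLin_eq_sum _ _ _ _ hN.1.2,
    orderedLin_eq_sum _ _ _ _ (hN.2.1.trans h₁), orderedLin_eq_sum _ _ _ _ hN.2.2]
  simp only [orderedSum, mul_one]

theorem aeval_diagOp (x : ℤ → ℂ) (p : ℂ[X]) (f : ℤ → ℂ × ℂ) (j : ℤ) :
    aeval (diagOp x x) p f j = p.eval (x j) • f j := by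
  induction p using Polynomial.induction_on with
  | C r => simp [Algebra.algebraMap_eq_smul_one]
  | add p r hp hr => simp [hp, hr, add_smul]
  | monomial n r h =>
    rw [pow_succ', mul_left_comm, map_mul, aeval_X, Module.End.mul_apply]
    change (_, _) = _
    rw [h]
    ext <;> simp <;> ring

variable {q a b c d r r' : ℂ} {u v u' v' x : ℤ → ℂ} {f : ℤ → ℂ × ℂ} {j : ℤ}

/-- The operator `k₀` built from a pair of block operators. -/
abbrev blockK₀ (q a b c d r r' : ℂ) (u v u' v' : ℤ → ℂ) : Module.End ℂ (ℤ → ℂ × ℂ) :=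
  IsDAHAQuad.k₀ q a b c d (withinOp u v r) (acrossOp u' v' r')

theorem blockK₀_apply_of_lt (hf : ∀ i, j < i → f i = 0) {i : ℤ} (hi : j + 1 < i) :
    blockK₀ q a b c d r r' u v u' v' f i = 0 := by
  have h₀ := hf i (by omega)
  have h₁ := hf (i + 1) (by omega)
  have h₂ := hf (i - 1) (by omega)
  simp [IsDAHAQuad.k₀, withinOp, acrossOp, h₀, h₁, h₂]

theorem blockK₀_apply_snd (hf : ∀ i, j < i → f i = 0) :
    (blockK₀ q a b c d r r' u v u' v' f (j + 1)).2 = (f j).2 := by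
  have h₀ := hf (j + 1) (by omega)
  have h₁ := hf (j + 1 + 1) (by omega)
  simp [IsDAHAQuad.k₀, withinOp, acrossOp, h₀, h₁]

/-- On the top entry of the support the operator is unipotent upper triangular because all lower
left entries of the blocks are 1. The off-diagonal term multiplies `(f j).2`, which is why that
component has to vanish here. -/
theorem blockK₀_apply_fst (hf : ∀ i, j < i → f i = 0) (hj : (f j).2 = 0) :
    (blockK₀ q a b c d r r' u v u' v' f (j + 1)).1 = (f j).1 := by
  have h₀ := hf (j + 1) (by omega)
  have h₁ := hf (j + 1 + 1) (by omega)
  simp [IsDAHAQuad.k₀, withinOp, acrossOp, h₀, h₁, hj]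

theorem blockK₀_pow_apply_of_lt (hf : ∀ i, j < i → f i = 0) (n : ℕ) {i : ℤ} (hi : j + n < i) :
    (blockK₀ q a b c d r r' u v u' v' ^ n) f i = 0 := by
  induction n generalizing i with
  | zero => exact hf i (by simpa using hi)
  | succ n ih =>
    rw [pow_succ', Module.End.mul_apply]
    exact blockK₀_apply_of_lt (fun i hi => ih hi) (by push_cast at hi; omega)

theorem blockK₀_pow_apply_snd (hf : ∀ i, j < i → f i = 0) (n : ℕ) :
    ((blockK₀ q a b c d r r' u v u' v' ^ n) f (j + n)).2 = (f j).2 := by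
  induction n with
  | zero => simp
  | succ n ih =>
    rw [pow_succ', Module.End.mul_apply, Nat.cast_succ, ← add_assoc,
      blockK₀_apply_snd (fun i hi => blockK₀_pow_apply_of_lt hf n hi), ih]

theorem blockK₀_pow_apply_fst (hf : ∀ i, j < i → f i = 0) (hj : (f j).2 = 0) (n : ℕ) :
    ((blockK₀ q a b c d r r' u v u' v' ^ n) f (j + n)).1 = (f j).1 := by
  induction n with
  | zero => simp
  | succ n ih =>
    rw [pow_succ', Module.End.mul_apply, Nat.cast_succ, ← add_assoc,
      blockK₀_apply_fst (fun i hi => blockK₀_pow_apply_of_lt hf n hi)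
        (by rw [blockK₀_pow_apply_snd hf, hj]), ih]

end Independence

section Independence

open Polynomial

variable {q a b c d r r' : ℂ} {u v u' v' x : ℤ → ℂ} {f : ℤ → ℂ × ℂ} {j : ℤ}

/-- The part of an ordered expression of top degree in `k₀`. -/
def orderedTop {A : Type*} [Ring A] [Algebra ℂ A] (k₀ k₁ : A) (P R : ℂ[X]) (N : ℕ) : A :=
  k₀ ^ (N + 1) * aeval k₁ P + k₀ ^ N * (k₁ * k₀) * aeval k₁ R

theorem aeval_diagOp_apply_of_lt (p : ℂ[X]) (hf : ∀ i, j < i → f i = 0) (i : ℤ) (hi : j < i) :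
    aeval (diagOp x x) p f i = 0 := by
  rw [aeval_diagOp, hf i hi, smul_zero]

theorem diagOp_apply (f : ℤ → ℂ × ℂ) (j : ℤ) : diagOp x x f j = x j • f j := rfl

theorem diagOp_blockK₀_apply_of_lt (p : ℂ[X]) (hf : ∀ i, j < i → f i = 0) (i : ℤ)
    (hi : j + 1 < i) :
    (diagOp x x * blockK₀ q a b c d r r' u v u' v' * aeval (diagOp x x) p) f i = 0 := by
  rw [Module.End.mul_apply, Module.End.mul_apply, diagOp_apply,
    blockK₀_apply_of_lt (aeval_diagOp_apply_of_lt p hf) hi, smul_zero]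

/-- The factor `x (j + 1)` arises because in `k₁ * k₀` the diagonal `k₁` acts after `k₀` has raised
the top index from `j` to `j + 1`. -/
theorem orderedTop_apply_snd (P R : ℂ[X]) (hf : ∀ i, j < i → f i = 0) (N : ℕ) :
    (orderedTop (blockK₀ q a b c d r r' u v u' v') (diagOp x x) P R N f (j + 1 + N)).2 =
      (P.eval (x j) + x (j + 1) * R.eval (x j)) * (f j).2 := by
  have h₁ := aeval_diagOp_apply_of_lt (x := x) P hf
  have h₂ := aeval_diagOp_apply_of_lt (x := x) R hf
  rw [orderedTop, mul_assoc _ _ (aeval _ R), LinearMap.add_apply, Module.End.mul_apply,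
    Module.End.mul_apply, Pi.add_apply, Prod.snd_add,
    blockK₀_pow_apply_snd (diagOp_blockK₀_apply_of_lt R hf), add_assoc j, add_comm 1 (N : ℤ),
    ← Nat.cast_succ, blockK₀_pow_apply_snd h₁, Module.End.mul_apply, Module.End.mul_apply,
    diagOp_apply, Prod.smul_snd, blockK₀_apply_snd h₂, aeval_diagOp, aeval_diagOp, Prod.smul_snd,
    Prod.smul_snd, smul_eq_mul, smul_eq_mul, smul_eq_mul]
  ring

theorem orderedTop_apply_fst (P R : ℂ[X]) (hf : ∀ i, j < i → f i = 0) (hj : (f j).2 = 0) (N : ℕ) :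
    (orderedTop (blockK₀ q a b c d r r' u v u' v') (diagOp x x) P R N f (j + 1 + N)).1 =
      (P.eval (x j) + x (j + 1) * R.eval (x j)) * (f j).1 := by
  have h₁ := aeval_diagOp_apply_of_lt (x := x) P hf
  have h₂ := aeval_diagOp_apply_of_lt (x := x) R hf
  have h₃ (p : ℂ[X]) : (aeval (diagOp x x) p f j).2 = 0 := by
    rw [aeval_diagOp, Prod.smul_snd, hj, smul_zero]
  have h₄ : ((diagOp x x * blockK₀ q a b c d r r' u v u' v' * aeval (diagOp x x) R) f (j + 1)).2
      = 0 := by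
    rw [Module.End.mul_apply, Module.End.mul_apply, diagOp_apply, Prod.smul_snd,
      blockK₀_apply_snd h₂, h₃, smul_zero]
  rw [orderedTop, mul_assoc _ _ (aeval _ R), LinearMap.add_apply, Module.End.mul_apply,
    Module.End.mul_apply, Pi.add_apply, Prod.fst_add,
    blockK₀_pow_apply_fst (diagOp_blockK₀_apply_of_lt R hf) h₄, add_assoc j, add_comm 1 (N : ℤ),
    ← Nat.cast_succ, blockK₀_pow_apply_fst h₁ (h₃ P), Module.End.mul_apply, Module.End.mul_apply,
    diagOp_apply, Prod.smul_fst, blockK₀_apply_fst h₂ (h₃ R), aeval_diagOp, aeval_diagOp,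
    Prod.smul_fst, Prod.smul_fst, smul_eq_mul, smul_eq_mul, smul_eq_mul]
  ring

theorem orderedTop_apply_of_lt (P R : ℂ[X]) (hf : ∀ i, j < i → f i = 0) (N : ℕ) {i : ℤ}
    (hi : j + 1 + N < i) :
    orderedTop (blockK₀ q a b c d r r' u v u' v') (diagOp x x) P R N f i = 0 := by
  rw [orderedTop, mul_assoc _ _ (aeval _ R), LinearMap.add_apply, Module.End.mul_apply,
    Module.End.mul_apply, Pi.add_apply,
    blockK₀_pow_apply_of_lt (diagOp_blockK₀_apply_of_lt R hf) N hi,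
    blockK₀_pow_apply_of_lt (aeval_diagOp_apply_of_lt P hf) _ (by push_cast; omega), add_zero]

theorem orderedSum_apply_of_lt (P R : ℕ → ℂ[X]) (hf : ∀ i, j < i → f i = 0) (N : ℕ) {i : ℤ}
    (hi : j + N < i) :
    orderedSum (blockK₀ q a b c d r r' u v u' v') (diagOp x x) P R N f i = 0 := by
  induction N generalizing i with
  | zero =>
    rw [orderedSum_zero]
    exact aeval_diagOp_apply_of_lt _ hf i (by simpa using hi)
  | succ N ih =>
    push_cast at hi
    rw [orderedSum_succ, LinearMap.add_apply, Pi.add_apply, ih (by omega), zero_add]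
    exact orderedTop_apply_of_lt (P (N + 1)) (R N) hf N (by omega)

/-- The top degree in `k₀` is peeled off by evaluating at delta functions `(1, 0)` supported at `j`.
Such a vector has second component 0 while its image under `withinOp` has second component 1, and
this separates the part multiplied by `T₁` from the part that is not. -/
theorem orderedSum_injective
    (hx : ∀ p s : ℂ[X], (∀ j, p.eval (x j) + x (j + 1) * s.eval (x j) = 0) → p = 0 ∧ s = 0)
    (P R P' R' : ℕ → ℂ[X]) (N : ℕ)
    (h : orderedSum (blockK₀ q a b c d r r' u v u' v') (diagOp x x) P R N +
      orderedSum (blockK₀ q a b c d r r' u v u' v') (diagOp x x) P' R' N * withinOp u v r = 0) :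
    (∀ n < N + 1, P n = 0 ∧ P' n = 0) ∧ ∀ n < N, R n = 0 ∧ R' n = 0 := by
  have hs (j : ℤ) : ∀ i, j < i → (Pi.single j (1, 0) : ℤ → ℂ × ℂ) i = 0 :=
    fun i hi => Pi.single_eq_of_ne hi.ne' _
  have ht (j : ℤ) : ∀ i, j < i → withinOp u v r (Pi.single j (1, 0)) i = 0 := fun i hi => by
    simp [withinOp, hs j i hi]
  have ht' (j : ℤ) : (withinOp u v r (Pi.single j (1, 0)) j).2 = 1 := by simp [withinOp]
  induction N with
  | zero =>
    rw [orderedSum_zero, orderedSum_zero] at h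
    have e (j : ℤ) := congrFun (LinearMap.congr_fun h (Pi.single j (1, 0))) j
    simp only [LinearMap.add_apply, Module.End.mul_apply, Pi.add_apply, aeval_diagOp,
      LinearMap.zero_apply, Pi.zero_apply, Prod.ext_iff, Prod.fst_add, Prod.snd_add,
      Prod.smul_fst, Prod.smul_snd, ht', Pi.single_eq_same, smul_eq_mul, mul_one, mul_zero,
      zero_add, Prod.snd_zero, Prod.fst_zero] at e
    have hP' := (hx (P' 0) 0 fun j => by rw [(e j).2]; simp).1
    have hP := (hx (P 0) 0 fun j => by simpa [hP'] using (e j).1).1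
    refine ⟨fun n hn => ?_, fun n hn => absurd hn n.not_lt_zero⟩
    obtain rfl : n = 0 := by omega
    exact ⟨hP, hP'⟩
  | succ N ih =>
    rw [orderedSum_succ, orderedSum_succ, ← orderedTop, ← orderedTop, add_mul,
      add_add_add_comm] at h
    have e (j : ℤ) := congrFun (LinearMap.congr_fun h (Pi.single j (1, 0))) (j + 1 + N)
    simp only [LinearMap.add_apply, Module.End.mul_apply, Pi.add_apply, LinearMap.zero_apply,
      Pi.zero_apply] at e
    have hlt (j : ℤ) : j + N < j + 1 + N := by omega
    simp only [orderedSum_apply_of_lt _ _ (hs _) N (hlt _),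
      orderedSum_apply_of_lt _ _ (ht _) N (hlt _), zero_add, add_zero] at e
    -- The second component sees only the terms multiplied by `withinOp`.
    have h' := hx (P' (N + 1)) (R' N) fun j => by
      have := congrArg Prod.snd (e j)
      rwa [Prod.snd_add, orderedTop_apply_snd _ _ (hs j), orderedTop_apply_snd _ _ (ht j), ht',
        Pi.single_eq_same, mul_zero, zero_add, mul_one] at this
    have hz : orderedTop (blockK₀ q a b c d r r' u v u' v') (diagOp x x) 0 0 N = 0 := by
      simp [orderedTop]
    simp only [h'.1, h'.2, hz, LinearMap.zero_apply, Pi.zero_apply, add_zero] at e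
    -- Once those terms vanish, the first component determines the rest.
    have h'' := hx (P (N + 1)) (R N) fun j => by
      have := congrArg Prod.fst (e j)
      rwa [orderedTop_apply_fst _ _ (hs j) (by simp), Pi.single_eq_same, mul_one] at this
    rw [h'.1, h'.2, h''.1, h''.2, hz, zero_mul, add_zero, add_zero] at h
    obtain ⟨i₁, i₂⟩ := ih h
    constructor
    · intro n hn
      rcases Nat.lt_succ_iff_lt_or_eq.1 hn with hn | rfl
      · exact i₁ n hn
      · exact ⟨h''.1, h'.1⟩
    · intro n hn
      rcases Nat.lt_succ_iff_lt_or_eq.1 hn with hn | rfl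
      · exact i₂ n hn
      · exact ⟨h''.2, h'.2⟩

theorem orderedSum_congr {A : Type*} [Ring A] [Algebra ℂ A] (k₀ k₁ : A) {P R : ℕ → ℂ[X]} {N : ℕ}
    (hP : ∀ n < N + 1, P n = 0) (hR : ∀ n < N, R n = 0) : orderedSum k₀ k₁ P R N = 0 := by
  rw [orderedSum, Finset.sum_eq_zero, Finset.sum_eq_zero, add_zero]
  · intro n hn; rw [hR n (Finset.mem_range.1 hn), map_zero, mul_zero]
  · intro n hn; rw [hP n (Finset.mem_range.1 hn), map_zero, mul_zero]

end Independence

/-! ### A generic orbit and injectivity -/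

/-- The excluded values of `w ^ 2` form a countable set, and every complex number is a square. -/
theorem exists_generic_point (q : ℂ) :
    ∃ w : ℂ, w ≠ 0 ∧ ∀ n : ℤ, w ^ 2 * q ^ n ≠ 1 := by
  have hS : ((Set.range fun n : ℤ => q ^ n) ∪ {0}).Countable :=
    (Set.countable_range _).union (Set.countable_singleton _)
  obtain ⟨s, hs⟩ : ∃ s, s ∉ (Set.range fun n : ℤ => q ^ n) ∪ {0} := by
    by_contra! h
    exact not_countable_complex (hS.mono fun s _ => h s)
  obtain ⟨w, rfl⟩ := IsAlgClosed.exists_pow_nat_eq s (n := 2) (by norm_num)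
  refine ⟨w, fun h => hs (Or.inr (by simp [h])), fun n h => hs (Or.inl ⟨-n, ?_⟩)⟩
  change q ^ (-n) = _
  rw [zpow_neg, ← eq_inv_of_mul_eq_one_left h]

theorem zpow_injective_of_pow_ne_one {q : ℂ} (hq : q ≠ 0) (hq₁ : ∀ m : ℕ, 1 ≤ m → q ^ m ≠ 1) :
    Function.Injective fun n : ℤ => q ^ n := by
  intro m n h
  change q ^ m = q ^ n at h
  by_contra hmn
  wlog hlt : m < n generalizing m n
  · exact this h.symm (Ne.symm hmn) (by omega)
  refine hq₁ (n - m).toNat (by omega) ?_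
  rw [← zpow_natCast, Int.toNat_of_nonneg (by omega), zpow_sub₀ hq, h,
    div_self (zpow_ne_zero _ hq)]

variable {q a b c d w : ℂ}

/-- The representation of the double affine Hecke algebra by `q`-difference-reflection
operators. -/
def rep (hq : q ≠ 0) (hw : w ≠ 0) (hqw : ∀ n : ℤ, w ^ 2 * q ^ n ≠ 1) :
    DAHA q a b c d →ₐ[ℂ] Module.End ℂ (ℤ → ℂ × ℂ) :=
  RingQuot.liftAlgHom ℂ ⟨FreeAlgebra.lift ℂ (repGen q a b c d w),
    fun _ _ h => repGen_rel hq hw hqw h⟩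

theorem rep_gen (hq : q ≠ 0) (hw : w ≠ 0) (hqw : ∀ n : ℤ, w ^ 2 * q ^ n ≠ 1) (x : DAHAGen) :
    rep (a := a) (b := b) (c := c) (d := d) hq hw hqw (DAHA.gen q a b c d x) =
      repGen q a b c d w x := by
  rw [rep, DAHA.gen, RingQuot.liftAlgHom_mkAlgHom_apply, FreeAlgebra.lift_ι_apply]

theorem DAHA.lift_injective (hq : q ≠ 0) (hq₁ : ∀ m : ℕ, 1 ≤ m → q ^ m ≠ 1) (ha : a ≠ 0)
    (hb : b ≠ 0) (hc : c ≠ 0) (hd : d ≠ 0) :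
    Function.Injective ((DAHA.isDAHAQuad hq ha hb hc hd).lift hq) := by
  obtain ⟨w, hw, hqw⟩ := exists_generic_point q
  set φ := (DAHA.isDAHAQuad hq ha hb hc hd).lift hq
  let ρ := (rep (a := a) (b := b) (c := c) (d := d) hq hw hqw).comp φ
  set x : ℤ → ℂ := fun j => pt q w j + (pt q w j)⁻¹
  -- `Z` acts on the two components at `j` by mutually inverse numbers, so `Z + Zinv` acts on both
  -- by the same scalar `x j`.
  have hK₁ : ρ (AWExt.gen q a b c d .K₁) = diagOp x x := by
    change rep hq hw hqw (φ _) = _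
    rw [IsDAHAQuad.lift_gen, IsDAHAQuad.genMap, map_add, rep_gen, rep_gen]
    refine LinearMap.ext fun f => funext fun j => ?_
    ext <;> simp [repGen, diagOp, x] <;> ring
  have hT₁ : ρ (AWExt.gen q a b c d .T₁) = repGen q a b c d w .T₁ := by
    change rep hq hw hqw (φ _) = _
    rw [IsDAHAQuad.lift_gen, IsDAHAQuad.genMap, rep_gen]
  have hK₀ : ρ (AWExt.gen q a b c d .K₀) =
      IsDAHAQuad.k₀ q a b c d (repGen q a b c d w .T₁) (repGen q a b c d w .T₀) := by
    change rep hq hw hqw (φ _) = _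
    rw [IsDAHAQuad.lift_gen, IsDAHAQuad.genMap]
    simp only [IsDAHAQuad.k₀, map_add, map_mul, map_smul, map_one, rep_gen]
  have hx (p s : Polynomial ℂ) (h : ∀ j, p.eval (x j) + x (j + 1) * s.eval (x j) = 0) :
      p = 0 ∧ s = 0 := by
    -- The next orbit point is `q` times the current one, so `x (j + 1)` is the factor `q t + (q
    -- t)⁻¹` at `t = pt q w j`.
    refine eq_zero_of_eval_add_eq_zero hq (hq₁ 2 (by norm_num)) (S := Set.range (pt q w))
      (Set.infinite_range_of_injective ?_) ?_ ?_
    · exact (mul_right_injective₀ hw).comp (zpow_injective_of_pow_ne_one hq hq₁)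
    · rintro _ ⟨j, rfl⟩
      exact mul_ne_zero hw (zpow_ne_zero _ hq)
    · rintro _ ⟨j, rfl⟩
      rw [← pt_add_one hq]
      exact h j
  refine (injective_iff_map_eq_zero φ).2 fun y hy => ?_
  have h₀ := AWExt.gen_rel (.comm_T₁_K₀ : AWRel q a b c d _ _)
  have h₁ := AWExt.gen_rel (.comm_T₁_K₁ : AWRel q a b c d _ _)
  rw [map_mul, map_mul] at h₀ h₁
  obtain ⟨N, P, R, P', R', rfl⟩ := exists_orderedSum_of_mem h₀ h₁
    ((AWExt.monomialSpan_eq_top q a b c d).symm ▸ Submodule.mem_top : y ∈ _)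
  have hρ := congrArg (rep hq hw hqw) hy
  rw [map_zero] at hρ
  change ρ _ = 0 at hρ
  rw [map_add, map_mul, map_orderedSum, map_orderedSum] at hρ
  change orderedSum (ρ (AWExt.gen q a b c d .K₀)) (ρ (AWExt.gen q a b c d .K₁)) P R N +
    orderedSum (ρ (AWExt.gen q a b c d .K₀)) (ρ (AWExt.gen q a b c d .K₁)) P' R' N *
      ρ (AWExt.gen q a b c d .T₁) = 0 at hρ
  rw [hK₁, hT₁, hK₀] at hρ
  obtain ⟨hP, hR⟩ := orderedSum_injective hx P R P' R' N hρ
  rw [orderedSum_congr _ _ (fun n hn => (hP n hn).1) fun n hn => (hR n hn).1,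
    orderedSum_congr _ _ (fun n hn => (hP n hn).2) fun n hn => (hR n hn).2, zero_mul, add_zero]

end ZhedanovDAHA

end

theorem corollary6p3 (q a b c d : ℂ) (hq : q ≠ 0) (hq1 : ∀ m : ℕ, 1 ≤ m → q ^ m ≠ 1)
    (ha : a ≠ 0) (hb : b ≠ 0) (hc : c ≠ 0) (hd : d ≠ 0)
    (habcd : ∀ m : ℕ, a * b * c * d ≠ (q ^ m)⁻¹) :
    ∃ Y : (ZhedanovDAHA.DAHA q a b c d)ˣ,
      (Y : ZhedanovDAHA.DAHA q a b c d)
          = ZhedanovDAHA.DAHA.gen q a b c d .T₁ * ZhedanovDAHA.DAHA.gen q a b c d .T₀ ∧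
      ∃ φ : ZhedanovDAHA.AWExt q a b c d →ₐ[ℂ] ZhedanovDAHA.DAHA q a b c d,
        φ (ZhedanovDAHA.AWExt.gen q a b c d .K₀)
          = (Y : ZhedanovDAHA.DAHA q a b c d)
            + (q⁻¹ * (a * b * c * d)) • ((Y⁻¹ : (ZhedanovDAHA.DAHA q a b c d)ˣ) :
                ZhedanovDAHA.DAHA q a b c d) ∧
        φ (ZhedanovDAHA.AWExt.gen q a b c d .K₁)
          = ZhedanovDAHA.DAHA.gen q a b c d .Z + ZhedanovDAHA.DAHA.gen q a b c d .Zinv ∧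
        φ (ZhedanovDAHA.AWExt.gen q a b c d .T₁) = ZhedanovDAHA.DAHA.gen q a b c d .T₁ ∧
        Function.Injective φ := by
  have h := ZhedanovDAHA.DAHA.isDAHAQuad hq ha hb hc hd
  have hu : q⁻¹ * (a * b * c * d) ≠ 0 :=
    mul_ne_zero (inv_ne_zero hq) (mul_ne_zero (mul_ne_zero (mul_ne_zero ha hb) hc) hd)
  exact ⟨h.unit hu, rfl, h.lift hq, (h.lift_gen hq _).trans (h.k₀_eq hu), h.lift_gen hq _,
    h.lift_gen hq _, ZhedanovDAHA.DAHA.lift_injective hq hq1 ha hb hc hd⟩
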